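/- For $\theta>0$ let $f(x\mid\theta)=\frac1\theta e^{-x/\theta}$ for $x>0$ (and $0$ otherwise), with parameter space $\Theta=(0,\infty)$. Let $n\ge 1$, $\theta_0>0$, let $X_1,\dots,X_n$ be i.i.d. with density $f(\cdot\mid\theta_0)$ (exponential with mean $\theta_0$), $\boldsymbol X=(X_1,\dots,X_n)$, $\bar X=\frac1n\sum_i X_i$, $L(\theta;\boldsymbol x)=\prod_{i=1}^n f(x_i\mid\theta)$ and $\ell=\log L$; $\mathbb E_\theta$ denotes expectation when the data have density $f(\cdot\mid\theta)$. (i) For every $\boldsymbol x\in(0,\infty)^n$ (hence almost surely for $\boldsymbol x=\boldsymbol X$) the maximiser of $L(\cdot\,;\boldsymbol x)$ over $\Theta$ exists, is unique, and equals the sample mean; thus $\hat\theta_n(\boldsymbol X)=\bar X$. (ii) The following regularity conditions hold. (R.C.1) Different $\theta$ give different densities. (R.C.2) $\Theta$ is open and $\ell(\cdot\,;\boldsymbol x)$ is three times continuously differentiable on $\Theta$ for every $\boldsymbol x\in(0,\infty)^n$. (R.C.3) For every $\theta_0\in\Theta$ there are $\epsilon(\theta_0)>0$ and a function $M$ with $(\theta_0-\epsilon(\theta_0),\theta_0+\epsilon(\theta_0))\subseteq\Theta$,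 $|\partial_\theta^3\ell(\theta;\boldsymbol x)|\le M(\boldsymbol x)$ for all $\boldsymbol x\in(0,\infty)^n$ and $|\theta-\theta_0|<\epsilon(\theta_0)$, and $\mathbb E_{\theta_0}|M(\boldsymbol X)|<\infty$. (R.C.4) $\mathbb E_\theta[\partial_\theta\log f(X_1\mid\theta)]=0$ for all $\theta\in\Theta$. (R.C.5) For all $\theta\in\Theta$ the Fisher information $I(\theta)=\mathbb E_\theta[(\partial_\theta\log f(X_1\mid\theta))^2]$ is finite and positive, and $nI(\theta)=\mathbb E_\theta[(\partial_\theta\ell(\theta;\boldsymbol X))^2]=-\mathbb E_\theta[\partial_\theta^2\ell(\theta;\boldsymbol X)]$. (O2) For every $\theta_0\in\Theta$, $\epsilon(\theta_0)$ and $M$ can be chosen as in (R.C.3) such that moreover, for all $0<\epsilon\le\epsilon(\theta_0)$ and $\kappa\in\{2,4\}$, the event $|\bar X-\theta_0|<\epsilon$ has positive probability and $\mathbb E_{\theta_0}\big[M(\boldsymbol X)^\kappa\,\big|\,|\bar X-\theta_0|<\epsilon\big]<\infty$. (O3) For all $\theta\in\Theta$, $\partial_\theta\log f(X_1\mid\theta)$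 has finite absolute moments under $\theta$ up to order five. (iii) Let $K\sim\chi^2_1$ and let $h:\mathbb R\to\mathbb R$ be bounded and twice continuously differentiable with bounded $h',h''$; $\|\cdot\|$ is the supremum norm. Put $$\Delta=\Big|\mathbb E\big[h\big(2(\ell(\bar X;\boldsymbol X)-\ell(\theta_0;\boldsymbol X))\big)\big]-\mathbb E[h(K)]\Big|,\qquad S=\frac{\sqrt2}{\theta_0^8\sqrt\pi}\Big(19\theta_0^4+325\theta_0^2+2733+\frac{36973}n\Big),$$ $$C=6\sqrt{3+\tfrac6n}+\sqrt{15+\tfrac{130}n+\tfrac{120}{n^2}}\Big(\tfrac{1120}3+\frac{320(3+\frac6n)^{1/4}+4}{\sqrt n}\Big)+\frac{6400}{\sqrt n}\sqrt{105+\tfrac{2380}n+\tfrac{7308}{n^2}+\tfrac{5040}{n^3}}.$$ Then $$\Delta<\frac{8\|h\|}n+S+\frac{\|h'\|}{\sqrt n}\,C,$$ and, if $h$ is not identically zero, also $$\Delta<\frac{8\|h\|}n+\frac{2(\|h'\|+\|h''\|)}{\sqrt n}\,S+\frac{\|h'\|}{\sqrt n}\,C .$$ In particular the second bound is $O(n^{-1/2})$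 for fixed $\theta_0$ and $h$. -/

import Mathlib

open MeasureTheory ProbabilityTheory

/-- A statistical model with a one-dimensional parameter for real-valued observations:
the parameter space `Θ` and the probability densities `f θ` (with respect to Lebesgue measure). -/
structure ParamModel where
  Θ : Set ℝ
  f : ℝ → ℝ → ℝ

namespace ParamModel

/-- The support of one observation. -/
def support (m : ParamModel) : Set ℝ := {x | ∃ θ ∈ m.Θ, 0 < m.f θ x}

/-- The support `𝕏` of a sample of size `n`. -/
def sampleSupport (m : ParamModel) (n : ℕ) : Set (Fin n → ℝ) := {x | ∀ i, x i ∈ m.support}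

/-- The law of one observation under the parameter `θ`. -/
noncomputable def law (m : ParamModel) (θ : ℝ) : Measure ℝ :=
  volume.withDensity fun x => ENNReal.ofReal (m.f θ x)

/-- The law of an i.i.d. sample of size `n` under the parameter `θ`. -/
noncomputable def sampleLaw (m : ParamModel) (n : ℕ) (θ : ℝ) : Measure (Fin n → ℝ) :=
  Measure.pi fun _ => m.law θ

/-- The likelihood `L(θ; x) = ∏ f(x_i | θ)`. -/
noncomputable def lik (m : ParamModel) {n : ℕ} (θ : ℝ) (x : Fin n → ℝ) : ℝ := ∏ i, m.f θ (x i)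

/-- The log-likelihood `ℓ(θ; x) = log L(θ; x)`. -/
noncomputable def loglik (m : ParamModel) {n : ℕ} (θ : ℝ) (x : Fin n → ℝ) : ℝ :=
  Real.log (m.lik θ x)

/-- `θ̂` is a maximum likelihood estimate for the sample `x`: a maximiser of the likelihood
over the parameter space. -/
def IsMLE (m : ParamModel) {n : ℕ} (x : Fin n → ℝ) (θhat : ℝ) : Prop :=
  θhat ∈ m.Θ ∧ ∀ θ ∈ m.Θ, m.lik θ x ≤ m.lik θhat x

/-- The score of one observation, `∂/∂θ log f(x | θ)`. -/
noncomputable def score (m : ParamModel) (θ x : ℝ) : ℝ := deriv (fun t => Real.log (m.f t x)) θ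

/-- The expected Fisher information number of one observation. -/
noncomputable def fisherInfo (m : ParamModel) (θ : ℝ) : ℝ := ∫ x, m.score θ x ^ 2 ∂(m.law θ)

/-- (R.C.1) The densities defined by two different parameters are distinct
(as elements of `L¹`, that is, not almost everywhere equal). -/
def RC1 (m : ParamModel) : Prop :=
  ∀ θ ∈ m.Θ, ∀ θ' ∈ m.Θ, θ ≠ θ' → ¬ (m.f θ =ᵐ[volume] m.f θ')

/-- (R.C.2) The log-likelihood is three times differentiable in the parameter, with continuous
third derivative. -/
def RC2 (m : ParamModel) (n : ℕ) : Prop :=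
  IsOpen m.Θ ∧ ∀ x ∈ m.sampleSupport n, ContDiffOn ℝ 3 (fun θ => m.loglik θ x) m.Θ

/-- `ε` and `M` are as required in (R.C.3) at the parameter `θ₀`: on the `ε`-neighbourhood of `θ₀`,
which lies in the parameter space, the third derivative of the log-likelihood is bounded by `M`,
and `M` has finite expectation. -/
def ThirdDerivBound (m : ParamModel) (n : ℕ) (θ₀ ε : ℝ) (M : (Fin n → ℝ) → ℝ) : Prop :=
  0 < ε ∧
  (∀ θ, |θ - θ₀| < ε → θ ∈ m.Θ ∧
    ∀ x ∈ m.sampleSupport n, |iteratedDeriv 3 (fun t => m.loglik t x) θ| ≤ M x) ∧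
  Integrable M (m.sampleLaw n θ₀)

/-- (R.C.3) -/
def RC3 (m : ParamModel) (n : ℕ) : Prop :=
  ∀ θ₀ ∈ m.Θ, ∃ (ε : ℝ) (M : (Fin n → ℝ) → ℝ), m.ThirdDerivBound n θ₀ ε M

/-- (R.C.4) The score of an observation has expectation zero. -/
def RC4 (m : ParamModel) : Prop :=
  ∀ θ ∈ m.Θ, Integrable (m.score θ) (m.law θ) ∧ ∫ x, m.score θ x ∂(m.law θ) = 0

/-- (R.C.5) The Fisher information `I(θ)` is finite and positive, and
`n I(θ) = E_θ[(∂ℓ/∂θ)²] = - E_θ[∂²ℓ/∂θ²]`. -/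
def RC5 (m : ParamModel) (n : ℕ) : Prop :=
  ∀ θ ∈ m.Θ,
    Integrable (fun x => m.score θ x ^ 2) (m.law θ) ∧ 0 < m.fisherInfo θ ∧
    Integrable (fun x => deriv (fun t => m.loglik t x) θ ^ 2) (m.sampleLaw n θ) ∧
    n * m.fisherInfo θ = ∫ x, deriv (fun t => m.loglik t x) θ ^ 2 ∂(m.sampleLaw n θ) ∧
    Integrable (fun x => iteratedDeriv 2 (fun t => m.loglik t x) θ) (m.sampleLaw n θ) ∧
    n * m.fisherInfo θ = - ∫ x, iteratedDeriv 2 (fun t => m.loglik t x) θ ∂(m.sampleLaw n θ)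

/-- (O2) for the estimator `θhat`: `ε(θ₀)` and `M` can be chosen as in (R.C.3) such that moreover
`E[M(X)^κ | |θhat(X) - θ₀| < ε] < ∞` for all `0 < ε ≤ ε(θ₀)` and `κ = 2, 4`; the conditioning
events have positive probability. -/
def O2 (m : ParamModel) (n : ℕ) (θhat : (Fin n → ℝ) → ℝ) : Prop :=
  ∀ θ₀ ∈ m.Θ, ∃ (ε₀ : ℝ) (M : (Fin n → ℝ) → ℝ), m.ThirdDerivBound n θ₀ ε₀ M ∧
    ∀ ε, 0 < ε → ε ≤ ε₀ →
      0 < m.sampleLaw n θ₀ {x | |θhat x - θ₀| < ε} ∧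
      ∀ κ ∈ ({2, 4} : Set ℕ), Integrable (fun x => M x ^ κ)
        (ProbabilityTheory.cond (m.sampleLaw n θ₀) {x | |θhat x - θ₀| < ε})

/-- (O3) The score of an observation has finite absolute moments up to order five. -/
def O3 (m : ParamModel) : Prop :=
  ∀ θ ∈ m.Θ, ∀ k ≤ 5, Integrable (fun x => |m.score θ x| ^ k) (m.law θ)

end ParamModel

/-- The exponential model parametrised by the mean `θ > 0`:
`f(x | θ) = θ⁻¹ exp(-x / θ)` for `x > 0`. -/
noncomputable def expModel : ParamModel where
  Θ := Set.Ioi 0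
  f θ x := if 0 < x then 1 / θ * Real.exp (-(1 / θ) * x) else 0

/-- The sample mean. -/
noncomputable def sampleMean {n : ℕ} (x : Fin n → ℝ) : ℝ := (∑ i, x i) / n

/-- The chi-square distribution with `k` degrees of freedom: the law of the sum of the squares of
`k` independent standard normal random variables. -/
noncomputable def chiSquaredMeasure (k : ℕ) : Measure ℝ :=
  (Measure.pi fun _ : Fin k => gaussianReal 0 1).map fun z => ∑ i, z i ^ 2

/-- The supremum norm of a real function (meaningful for bounded functions). -/
noncomputable def supNorm (g : ℝ → ℝ) : ℝ := ⨆ x, |g x|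

/-- `h ∈ C_b²(ℝ)`: twice continuously differentiable, bounded, with bounded first and second
derivatives. -/
structure IsCb2 (h : ℝ → ℝ) : Prop where
  contDiff : ContDiff ℝ 2 h
  bdd : ∃ C, ∀ x, |h x| ≤ C
  bdd_deriv : ∃ C, ∀ x, |deriv h x| ≤ C
  bdd_deriv_two : ∃ C, ∀ x, |iteratedDeriv 2 h x| ≤ C

/-- `(√2 / (θ₀⁸ √π)) (19 θ₀⁴ + 325 θ₀² + 2733 + 36973 / n)`. -/
noncomputable def scoreTerm (θ₀ : ℝ) (n : ℕ) : ℝ :=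
  √2 / (θ₀ ^ 8 * √Real.pi) * (19 * θ₀ ^ 4 + 325 * θ₀ ^ 2 + 2733 + 36973 / n)

/-- The constant in braces that multiplies `‖h'‖ / √n`. -/
noncomputable def remainderTerm (n : ℕ) : ℝ :=
  6 * √(3 + 6 / (n : ℝ)) +
  √(15 + 130 / (n : ℝ) + 120 / (n : ℝ) ^ 2) *
    (1120 / 3 + (320 * (3 + 6 / (n : ℝ)) ^ (1 / 4 : ℝ) + 4) / √(n : ℝ)) +
  6400 / √(n : ℝ) *
    √(105 + 2380 / (n : ℝ) + 7308 / (n : ℝ) ^ 2 + 5040 / (n : ℝ) ^ 3)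

/-! For the exponential model the Wilks statistic is exactly 2n·D(Y), where D(y) = y - 1 - log y and
Y, the sample mean divided by `θ₀`, has a gamma law of shape n and mean 1 (`loglik_sampleMean_sub`,
`hasLaw_sum_gammaMeasure`). No Taylor expansion or Stein argument is needed: two explicit densities
on (0, ∞) are compared.

The reference is the law of Y making the signed root sign(Y - 1)·√(2n·D(Y)) standard normal, so that
2n·D(Y) is exactly chi-square (`map_devianceLaw`). The gamma law has density kρ with respect to it,
where k is Stirling's approximation of n! over n! and ρ(y) = √(2D(y)) / |y - 1|
(`map_gammaMeasure_div`). The inequality |ρ - 1| ≤ √(2D) = √(G/n), with G = 2nD, shows that kρ is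
within O(n^(-1/2)) of 1 in a weighted sense. As |h(G) - h(0)| ≤ ‖h'‖·G and G has first two moments 1
and 3, the error is at most 3‖h'‖/√n (`abs_integral_withDensity_sub_le`).

This is dominated by the `remainderTerm` summand alone, so both stated bounds follow, the other
summands only supplying strictness. The maximiser is found from the sign of D, and the regularity
conditions from explicit derivatives and moments. -/

/-! ### Elementary inequalities for y - 1 - log y. -/

/-- The function `y ↦ y - 1 - log y`, half the likelihood ratio statistic of one exponential
observation per unit of sample size. -/
noncomputable def halfDeviance (y : ℝ) : ℝ := y - 1 - Real.log y

lemma measurable_halfDeviance : Measurable halfDeviance := by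
  unfold halfDeviance; fun_prop

lemma halfDeviance_nonneg {y : ℝ} (hy : 0 < y) : 0 ≤ halfDeviance y := by
  have := Real.log_le_sub_one_of_pos hy
  unfold halfDeviance; linarith

lemma halfDeviance_pos {y : ℝ} (hy : 0 < y) (h1 : y ≠ 1) : 0 < halfDeviance y := by
  have := Real.log_lt_sub_one_of_pos hy h1
  unfold halfDeviance; linarith

lemma hasDerivAt_halfDeviance {y : ℝ} (hy : 0 < y) : HasDerivAt halfDeviance (1 - 1 / y) y := by
  have := ((hasDerivAt_id y).sub_const 1).sub (Real.hasDerivAt_log hy.ne')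
  convert! this using 1
  simp [one_div]

lemma monotoneOn_halfDeviance : MonotoneOn halfDeviance (Set.Ici 1) := by
  have hpos : ∀ y ∈ Set.Ici (1 : ℝ), 0 < y := fun y hy => lt_of_lt_of_le one_pos hy
  refine monotoneOn_of_deriv_nonneg (convex_Ici 1)
    (fun y hy => (hasDerivAt_halfDeviance (hpos y hy)).continuousAt.continuousWithinAt)
    (fun y hy => (hasDerivAt_halfDeviance
      (hpos y (interior_subset hy))).differentiableAt.differentiableWithinAt) fun y hy => ?_
  have hy1 : 1 ≤ y := interior_subset hy
  rw [(hasDerivAt_halfDeviance (hpos y hy1)).deriv, sub_nonneg, div_le_one (by linarith)]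
  exact hy1

lemma antitoneOn_halfDeviance : AntitoneOn halfDeviance (Set.Ioc 0 1) := by
  refine antitoneOn_of_deriv_nonpos (convex_Ioc 0 1)
    (fun y hy => (hasDerivAt_halfDeviance hy.1).continuousAt.continuousWithinAt)
    (fun y hy => (hasDerivAt_halfDeviance
      (interior_subset hy).1).differentiableAt.differentiableWithinAt) fun y hy => ?_
  have hy1 := interior_subset hy
  rw [(hasDerivAt_halfDeviance hy1.1).deriv, sub_nonpos, le_div_iff₀ hy1.1]
  linarith [hy1.2]

/-- The derivative is -2(y - 1)²/y. Since the function vanishes at 1, monotonicity yields the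
comparison with (y - 1)² in opposite directions on the two sides of 1. -/
lemma antitoneOn_two_mul_halfDeviance_sub_sq :
    AntitoneOn (fun y => 2 * halfDeviance y - (y - 1) ^ 2) (Set.Ioi 0) := by
  have hd : ∀ y ∈ Set.Ioi (0 : ℝ), HasDerivAt (fun y => 2 * halfDeviance y - (y - 1) ^ 2)
      (2 * (1 - 1 / y) - 2 * (y - 1)) y := fun y hy => by
    have := ((hasDerivAt_halfDeviance hy).const_mul 2).sub
      (((hasDerivAt_id y).sub_const 1).pow 2)
    convert! this using 1
    simp
  refine antitoneOn_of_deriv_nonpos (convex_Ioi 0)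
    (fun y hy => (hd y hy).continuousAt.continuousWithinAt)
    (fun y hy => (hd y (interior_subset hy)).differentiableAt.differentiableWithinAt)
    fun y hy => ?_
  have hy0 : 0 < y := interior_subset hy
  rw [(hd y hy0).deriv]
  have : 2 * (1 - 1 / y) - 2 * (y - 1) = -(2 * (y - 1) ^ 2 / y) := by field_simp; ring
  rw [this]
  have : 0 ≤ 2 * (y - 1) ^ 2 / y := by positivity
  linarith

lemma two_mul_halfDeviance_le_sq {y : ℝ} (hy : 1 ≤ y) : 2 * halfDeviance y ≤ (y - 1) ^ 2 := by
  have := antitoneOn_two_mul_halfDeviance_sub_sq (a := 1) (b := y) (by simp)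
    (lt_of_lt_of_le one_pos hy) hy
  simp only [halfDeviance, Real.log_one] at this ⊢
  linarith

lemma sq_le_two_mul_halfDeviance {y : ℝ} (hy0 : 0 < y) (hy : y ≤ 1) :
    (y - 1) ^ 2 ≤ 2 * halfDeviance y := by
  have := antitoneOn_two_mul_halfDeviance_sub_sq (a := y) (b := 1) hy0 (by simp) hy
  simp only [halfDeviance, Real.log_one] at this ⊢
  linarith

/-- With y = exp t this is t ≤ sinh t. -/
lemma log_le_half_sub_inv {y : ℝ} (hy : 1 ≤ y) : Real.log y ≤ (y - y⁻¹) / 2 := by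
  rw [← Real.sinh_log (by linarith)]
  exact Real.self_le_sinh_iff.2 (Real.log_nonneg hy)

lemma sq_div_le_two_mul_halfDeviance {y : ℝ} (hy : 1 ≤ y) :
    (y - 1) ^ 2 / y ≤ 2 * halfDeviance y := by
  have := log_le_half_sub_inv hy
  have e : (y - 1) ^ 2 / y = y - 2 + y⁻¹ := by
    have : y ≠ 0 := by linarith
    field_simp; ring
  rw [e, halfDeviance]; linarith

lemma two_mul_halfDeviance_le_sq_div {y : ℝ} (hy0 : 0 < y) (hy : y ≤ 1) :
    2 * halfDeviance y ≤ (y - 1) ^ 2 / y := by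
  have := log_le_half_sub_inv ((one_le_inv₀ hy0).2 hy)
  rw [Real.log_inv, inv_inv] at this
  have e : (y - 1) ^ 2 / y = y - 2 + y⁻¹ := by field_simp; ring
  rw [e, halfDeviance]; linarith

/-- Write A for the root. A² lies between (y - 1)² and (y - 1)²/y, in an order depending on the side
of 1. One comparison fixes the sign of A - |y - 1|; the other reduces the claim to comparing A·y
with |y - 1|, and there A²y² is compared with A²y. -/
lemma abs_sqrt_halfDeviance_div_sub_one_le {y : ℝ} (hy0 : 0 < y) (hy1 : y ≠ 1) :
    |√(2 * halfDeviance y) / |y - 1| - 1| ≤ √(2 * halfDeviance y) := by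
  set A := √(2 * halfDeviance y) with hA
  have hA0 : 0 ≤ A := Real.sqrt_nonneg _
  have hsq : A ^ 2 = 2 * halfDeviance y :=
    Real.sq_sqrt (mul_nonneg two_pos.le (halfDeviance_nonneg hy0))
  have hu : 0 < |y - 1| := abs_pos.2 (sub_ne_zero.2 hy1)
  have e : A / |y - 1| - 1 = (A - |y - 1|) / |y - 1| := by field_simp
  rw [e, abs_div, abs_abs, div_le_iff₀ hu]
  rcases lt_or_gt_of_ne hy1 with h | h
  · have h1 := sq_le_two_mul_halfDeviance hy0 h.le
    have h2 := two_mul_halfDeviance_le_sq_div hy0 h.le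
    rw [abs_of_neg (sub_neg.2 h)]
    rw [← hsq] at h1 h2
    rw [le_div_iff₀ hy0] at h2
    have h3 : -(y - 1) ≤ A := abs_le_of_sq_le_sq' (by nlinarith) hA0 |>.2
    rw [abs_of_nonneg (by linarith)]
    have h4 : A * y ≤ 1 - y := by
      refine (abs_le_of_sq_le_sq' ?_ (by linarith)).2
      nlinarith [sq_nonneg A]
    linarith
  · have h1 := two_mul_halfDeviance_le_sq h.le
    have h2 := sq_div_le_two_mul_halfDeviance h.le
    rw [abs_of_pos (sub_pos.2 h)]
    rw [← hsq] at h1 h2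
    rw [div_le_iff₀ hy0] at h2
    have h3 : A ≤ y - 1 := abs_le_of_sq_le_sq' h1 (by linarith) |>.2
    rw [abs_of_nonpos (by linarith)]
    have h4 : y - 1 ≤ A * y := by
      refine (abs_le_of_sq_le_sq' ?_ (by positivity)).2
      nlinarith [sq_nonneg A, mul_nonneg (sq_nonneg A) hy0.le]
    linarith

/-! ### The signed root as a change of variables to the standard normal. -/

lemma hasDerivAt_sqrt_halfDeviance {y : ℝ} (hy : 0 < y) (h1 : y ≠ 1) :
    HasDerivAt (fun y => √(2 * halfDeviance y)) ((1 - 1 / y) / √(2 * halfDeviance y)) y := by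
  have hp : 2 * halfDeviance y ≠ 0 := (mul_pos two_pos (halfDeviance_pos hy h1)).ne'
  have := ((hasDerivAt_halfDeviance hy).const_mul 2).sqrt hp
  convert! this using 1
  field_simp

lemma image_sqrt_halfDeviance_Ioi {c : ℝ} (hc : 0 < c) :
    (fun y => c * √(2 * halfDeviance y)) '' Set.Ioi 1 = Set.Ioi 0 := by
  ext r
  simp only [Set.mem_image, Set.mem_Ioi]
  constructor
  · rintro ⟨y, hy, rfl⟩
    exact mul_pos hc (Real.sqrt_pos.2
      (mul_pos two_pos (halfDeviance_pos (one_pos.trans hy) hy.ne')))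
  · intro hr
    set t := (r / c) ^ 2 / 2 with ht
    have ht0 : 0 < t := by positivity
    -- The endpoint 2t + 2 is large enough for the intermediate value theorem: (y - 1)²/y ≥ 2t
    -- there.
    have hcont : ContinuousOn halfDeviance (Set.Icc 1 (2 * t + 2)) := fun y hy =>
      (hasDerivAt_halfDeviance (lt_of_lt_of_le one_pos hy.1)).continuousAt.continuousWithinAt
    have hmem : t ∈ Set.Icc (halfDeviance 1) (halfDeviance (2 * t + 2)) := by
      constructor
      · simpa [halfDeviance] using ht0.le
      · have := sq_div_le_two_mul_halfDeviance (y := 2 * t + 2) (by linarith)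
        have h2 : 2 * t ≤ (2 * t + 2 - 1) ^ 2 / (2 * t + 2) := by
          rw [le_div_iff₀ (by linarith)]; nlinarith
        linarith
    obtain ⟨y, hy, hyt⟩ := intermediate_value_Icc (by linarith) hcont hmem
    refine ⟨y, lt_of_le_of_ne hy.1 ?_, ?_⟩
    · rintro rfl
      simp [halfDeviance] at hyt
      linarith
    · rw [hyt, ht, mul_div_cancel₀ _ two_ne_zero, Real.sqrt_sq (by positivity)]
      field_simp

lemma image_neg_sqrt_halfDeviance_Ioo {c : ℝ} (hc : 0 < c) :
    (fun y => -(c * √(2 * halfDeviance y))) '' Set.Ioo 0 1 = Set.Iio 0 := by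
  ext r
  simp only [Set.mem_image, Set.mem_Iio]
  constructor
  · rintro ⟨y, hy, rfl⟩
    exact neg_neg_of_pos (mul_pos hc (Real.sqrt_pos.2
      (mul_pos two_pos (halfDeviance_pos hy.1 hy.2.ne))))
  · intro hr
    set t := (r / c) ^ 2 / 2 with ht
    have hrc : r / c < 0 := div_neg_of_neg_of_pos hr hc
    have ht0 : 0 < t := by have := sq_pos_of_neg hrc; positivity
    -- At exp(-t - 1) the deviance is t + exp(-t - 1), which exceeds t.
    have hb : Real.exp (-t - 1) ≤ 1 := Real.exp_le_one_iff.2 (by linarith)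
    have hcont : ContinuousOn halfDeviance (Set.Icc (Real.exp (-t - 1)) 1) := fun y hy =>
      (hasDerivAt_halfDeviance
        (lt_of_lt_of_le (Real.exp_pos _) hy.1)).continuousAt.continuousWithinAt
    have hmem : t ∈ Set.Icc (halfDeviance 1) (halfDeviance (Real.exp (-t - 1))) := by
      constructor
      · simpa [halfDeviance] using ht0.le
      · have := Real.exp_pos (-t - 1)
        rw [halfDeviance, Real.log_exp]; linarith
    obtain ⟨y, hy, hyt⟩ := intermediate_value_Icc' hb hcont hmem
    refine ⟨y, ⟨lt_of_lt_of_le (Real.exp_pos _) hy.1, lt_of_le_of_ne hy.2 ?_⟩, ?_⟩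
    · rintro rfl
      simp [halfDeviance] at hyt
      linarith
    · rw [hyt, ht, mul_div_cancel₀ _ two_ne_zero, Real.sqrt_sq_eq_abs,
        abs_of_neg hrc]
      field_simp

/-- The density on `(0, ∞)` of the variable whose signed root deviance is standard normal. -/
noncomputable def devianceWeight (n y : ℝ) : ℝ :=
  √(n / (2 * Real.pi)) * Real.exp (-(n * halfDeviance y)) * (|1 - 1 / y| / √(2 * halfDeviance y))

lemma measurable_devianceWeight (n : ℝ) : Measurable (devianceWeight n) := by
  have := measurable_halfDeviance
  unfold devianceWeight; fun_prop

lemma devianceWeight_nonneg (n y : ℝ) : 0 ≤ devianceWeight n y := by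
  unfold devianceWeight; positivity

lemma gaussianPDFReal_mul_deriv {n y : ℝ} (hn : 0 < n) (hy : 0 < y) :
    |√n * ((1 - 1 / y) / √(2 * halfDeviance y))| *
      gaussianPDFReal 0 1 (√n * √(2 * halfDeviance y)) = devianceWeight n y := by
  have e : (√n * √(2 * halfDeviance y)) ^ 2 = 2 * (n * halfDeviance y) := by
    rw [mul_pow, Real.sq_sqrt hn.le,
      Real.sq_sqrt (mul_nonneg two_pos.le (halfDeviance_nonneg hy))]; ring
  rw [gaussianPDFReal, devianceWeight, sub_zero, e, abs_mul, abs_div,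
    abs_of_nonneg (Real.sqrt_nonneg n), abs_of_nonneg (Real.sqrt_nonneg (2 * halfDeviance y)),
    Real.sqrt_div hn.le]
  simp only [NNReal.coe_one, mul_one]
  rw [neg_div, mul_div_cancel_left₀ _ (two_ne_zero)]
  field_simp

/-- The signed root maps (0, 1) onto the negative half-line and (1, ∞) onto the positive one. Both
pieces have the same Jacobian formula up to sign, which the absolute value in `devianceWeight`
absorbs. -/
lemma lintegral_sq_gaussianReal {n : ℝ} (hn : 0 < n) {F : ℝ → ENNReal} (hF : Measurable F) :
    ∫⁻ z, F (z ^ 2) ∂gaussianReal 0 1 =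
      ∫⁻ y in Set.Ioi 0, ENNReal.ofReal (devianceWeight n y) * F (2 * n * halfDeviance y) := by
  have hsn : 0 < √n := Real.sqrt_pos.2 hn
  have key : ∀ y, 0 < y → (√n * √(2 * halfDeviance y)) ^ 2 = 2 * n * halfDeviance y := by
    intro y hy
    rw [mul_pow, Real.sq_sqrt hn.le,
      Real.sq_sqrt (mul_nonneg two_pos.le (halfDeviance_nonneg hy))]; ring
  have hsplit : ∀ G : ℝ → ENNReal,
      ∫⁻ y in Set.Ioi 0, G y = (∫⁻ y in Set.Ioo 0 1, G y) + ∫⁻ y in Set.Ioi 1, G y := by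
    intro G
    rw [← Set.Ioo_union_Ici_eq_Ioi one_pos, lintegral_union measurableSet_Ici (by
      rw [Set.disjoint_left]; intro y hy hy'; exact absurd hy.2 (not_lt.2 hy')),
      setLIntegral_congr (Ioi_ae_eq_Ici (a := (1 : ℝ))).symm]
  rw [gaussianReal_of_var_ne_zero _ one_ne_zero,
    lintegral_withDensity_eq_lintegral_mul _ (measurable_gaussianPDF 0 1) (by fun_prop), hsplit,
    ← lintegral_add_compl _ measurableSet_Iio (A := Set.Iio 0), Set.compl_Iio,
    setLIntegral_congr Ioi_ae_eq_Ici.symm]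
  congr 1
  -- The deviance decreases on (0, 1), so its negated root increases and the monotone change of
  -- variables applies.
  · rw [← image_neg_sqrt_halfDeviance_Ioo hsn,
      lintegral_image_eq_lintegral_deriv_mul_of_monotoneOn
        (f := fun y => -(√n * √(2 * halfDeviance y))) measurableSet_Ioo
        (fun y hy => (((hasDerivAt_sqrt_halfDeviance hy.1 hy.2.ne).const_mul _).neg).hasDerivWithinAt)
        (fun y hy z hz hyz => neg_le_neg (mul_le_mul_of_nonneg_left (Real.sqrt_le_sqrt
          (mul_le_mul_of_nonneg_left (antitoneOn_halfDeviance ⟨hy.1, hy.2.le⟩ ⟨hz.1, hz.2.le⟩ hyz)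
            two_pos.le)) hsn.le))]
    refine setLIntegral_congr_fun measurableSet_Ioo fun y hy => ?_
    have hd : √n * ((1 - 1 / y) / √(2 * halfDeviance y)) ≤ 0 :=
      mul_nonpos_of_nonneg_of_nonpos hsn.le (div_nonpos_of_nonpos_of_nonneg
        (sub_nonpos.2 ((le_div_iff₀ hy.1).2 (by linarith [hy.2]))) (Real.sqrt_nonneg _))
    have := gaussianPDFReal_mul_deriv hn hy.1
    rw [abs_of_nonpos hd] at this
    have hs : gaussianPDFReal 0 1 (-(√n * √(2 * halfDeviance y))) =
        gaussianPDFReal 0 1 (√n * √(2 * halfDeviance y)) := by simp [gaussianPDFReal]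
    simp only [Pi.mul_apply, neg_sq, key y hy.1, gaussianPDF, hs]
    rw [← mul_assoc, ← ENNReal.ofReal_mul (by linarith), this]
  · rw [← image_sqrt_halfDeviance_Ioi hsn,
      lintegral_image_eq_lintegral_deriv_mul_of_monotoneOn measurableSet_Ioi
        (fun y (hy : 1 < y) => ((hasDerivAt_sqrt_halfDeviance (one_pos.trans hy)
          hy.ne').const_mul _).hasDerivWithinAt)
        (fun y (hy : 1 < y) z (hz : 1 < z) hyz => mul_le_mul_of_nonneg_left (Real.sqrt_le_sqrt
          (mul_le_mul_of_nonneg_left (monotoneOn_halfDeviance hy.le hz.le hyz)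
            two_pos.le)) hsn.le)]
    refine setLIntegral_congr_fun measurableSet_Ioi fun y (hy : 1 < y) => ?_
    have hy0 : 0 < y := one_pos.trans hy
    have hd : 0 ≤ √n * ((1 - 1 / y) / √(2 * halfDeviance y)) :=
      mul_nonneg hsn.le (div_nonneg
        (sub_nonneg.2 ((div_le_iff₀ hy0).2 (by linarith))) (Real.sqrt_nonneg _))
    have := gaussianPDFReal_mul_deriv hn hy0
    rw [abs_of_nonneg hd] at this
    simp only [Pi.mul_apply, key y hy0, gaussianPDF]
    rw [← mul_assoc, ← ENNReal.ofReal_mul hd, this]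

/-- The law on `(0, ∞)` under which the signed root of `2 * n * halfDeviance` is standard normal. -/
noncomputable def devianceLaw (n : ℝ) : Measure ℝ :=
  (volume.restrict (Set.Ioi 0)).withDensity fun y => ENNReal.ofReal (devianceWeight n y)

lemma map_devianceLaw {n : ℝ} (hn : 0 < n) :
    (devianceLaw n).map (fun y => 2 * n * halfDeviance y) =
      (gaussianReal 0 1).map fun z => z ^ 2 := by
  have hm := measurable_halfDeviance
  have hw := measurable_devianceWeight n
  refine Measure.ext_of_lintegral _ fun F hF => ?_
  rw [lintegral_map hF (by fun_prop), lintegral_map hF (by fun_prop),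
    lintegral_sq_gaussianReal hn hF, devianceLaw,
    lintegral_withDensity_eq_lintegral_mul _ (by fun_prop) (by fun_prop)]
  rfl

/-- Total mass one is read off from the push-forward, a chi-square law, instead of being computed
from the density. -/
lemma isProbabilityMeasure_devianceLaw {n : ℝ} (hn : 0 < n) :
    IsProbabilityMeasure (devianceLaw n) := by
  have hm := measurable_halfDeviance
  have h : IsProbabilityMeasure ((devianceLaw n).map (fun y => 2 * n * halfDeviance y)) := by
    rw [map_devianceLaw hn]
    exact Measure.isProbabilityMeasure_map (by fun_prop)
  exact Measure.isProbabilityMeasure_of_map (f := fun y => 2 * n * halfDeviance y)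

lemma ae_devianceLaw (n : ℝ) : ∀ᵐ y ∂devianceLaw n, 0 < y ∧ y ≠ 1 := by
  refine (withDensity_absolutelyContinuous _ _).ae_le ?_
  filter_upwards [ae_restrict_mem measurableSet_Ioi,
    ae_restrict_of_ae (Measure.ae_ne volume (1 : ℝ))] with y h1 h2
  exact ⟨h1, h2⟩

lemma integral_devianceLaw {n : ℝ} (hn : 0 < n) {F : ℝ → ℝ} (hF : Measurable F) :
    ∫ y, F (2 * n * halfDeviance y) ∂devianceLaw n = ∫ z, F (z ^ 2) ∂gaussianReal 0 1 := by
  have hm := measurable_halfDeviance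
  rw [← integral_map (φ := fun y => 2 * n * halfDeviance y) (by fun_prop)
    hF.aestronglyMeasurable, map_devianceLaw hn,
    integral_map (by fun_prop) hF.aestronglyMeasurable]

lemma integrable_devianceLaw {n : ℝ} (hn : 0 < n) {F : ℝ → ℝ} (hF : Measurable F)
    (hi : Integrable (fun z => F (z ^ 2)) (gaussianReal 0 1)) :
    Integrable (fun y => F (2 * n * halfDeviance y)) (devianceLaw n) := by
  have hm := measurable_halfDeviance
  have : Integrable F ((devianceLaw n).map (fun y => 2 * n * halfDeviance y)) := by
    rw [map_devianceLaw hn]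
    exact (integrable_map_measure hF.aestronglyMeasurable (by fun_prop)).2 hi
  exact this.comp_measurable (by fun_prop)

/-! ### Gaussian moments. -/

lemma integrable_pow_gaussianReal (k : ℕ) : Integrable (fun z => z ^ k) (gaussianReal 0 1) := by
  have := (memLp_id_gaussianReal (μ := 0) (v := 1) k).integrable_norm_pow'
  refine this.mono' (by fun_prop) (Filter.Eventually.of_forall fun z => ?_)
  simp

lemma integral_sq_gaussianReal : ∫ z, z ^ 2 ∂gaussianReal 0 1 = 1 := by
  have := variance_id_gaussianReal (μ := 0) (v := 1)
  rw [variance_eq_integral (by fun_prop)] at this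
  simpa using this

/-- By evenness this is a half-line integral, evaluated through Γ(5/2) = (3/4)√π. -/
lemma integral_pow_four_gaussianReal : ∫ z, z ^ 4 ∂gaussianReal 0 1 = 3 := by
  have hG : Real.Gamma ((4 + 1) / 2) = 3 / 4 * √Real.pi := by
    rw [show ((4 : ℝ) + 1) / 2 = 3 / 2 + 1 by norm_num, Real.Gamma_add_one (by norm_num),
      show (3 : ℝ) / 2 = 1 / 2 + 1 by norm_num, Real.Gamma_add_one (by norm_num),
      Real.Gamma_one_half_eq]
    ring
  have hI := integral_rpow_mul_exp_neg_mul_rpow (p := 2) (q := 4) (b := 1 / 2) two_pos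
    (by norm_num) (by norm_num)
  have hb : (1 / 2 : ℝ) ^ (-((4 : ℝ) + 1) / 2) = 4 * √2 := by
    rw [one_div, Real.inv_rpow two_pos.le, ← Real.rpow_neg two_pos.le,
      show -(-((4 : ℝ) + 1) / 2) = 2 + 1 / 2 by norm_num, Real.rpow_add two_pos,
      ← Real.sqrt_eq_rpow]
    norm_num
  rw [hG, hb] at hI
  rw [integral_gaussianReal_eq_integral_smul one_ne_zero]
  have e : ∀ z : ℝ, gaussianPDFReal 0 1 z • z ^ 4 =
      (√(2 * Real.pi))⁻¹ * (fun x : ℝ => x ^ 4 * Real.exp (-(1 / 2) * x ^ 2)) |z| := by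
    intro z
    simp only [gaussianPDFReal, NNReal.coe_one, mul_one, sub_zero, smul_eq_mul, sq_abs]
    rw [show |z| ^ 4 = z ^ 4 by rw [← abs_pow, abs_of_nonneg (by positivity)]]
    ring_nf
  simp_rw [e]
  rw [integral_const_mul,
    integral_comp_abs (f := fun x : ℝ => x ^ 4 * Real.exp (-(1 / 2) * x ^ 2))]
  have hI' : ∫ x in Set.Ioi (0 : ℝ), x ^ 4 * Real.exp (-(1 / 2) * x ^ 2) =
      4 * √2 * (1 / 2) * (3 / 4 * √Real.pi) := by
    rw [← hI]
    exact_mod_cast rfl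
  rw [hI', Real.sqrt_mul two_pos.le]
  have : 0 < √Real.pi := Real.sqrt_pos.2 Real.pi_pos
  field_simp

/-! ### The gamma law compared with the reference law. -/

/-- Stirling's approximation of `n!`, divided by `n!`. -/
noncomputable def stirlingRatio (n : ℕ) : ℝ :=
  √(2 * Real.pi * n) * (n / Real.exp 1) ^ n / n.factorial

lemma stirlingRatio_nonneg (n : ℕ) : 0 ≤ stirlingRatio n := by unfold stirlingRatio; positivity

lemma stirlingRatio_le_one (n : ℕ) : stirlingRatio n ≤ 1 := by
  unfold stirlingRatio
  rw [div_le_one (by positivity)]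
  exact Stirling.le_factorial_stirling n

/-- The exponential factor is common to both densities because exp(-nD(y)) = eⁿ yⁿ exp(-ny). The
remaining constants assemble into the Stirling ratio, and the extra 1/y comes from |1 - 1/y| = |y -
1|/y. -/
lemma mul_gammaPDFReal_mul {n : ℕ} (hn : 1 ≤ n) {r : ℝ} (hr : 0 < r) {y : ℝ} (hy : 0 < y)
    (h1 : y ≠ 1) :
    n / r * gammaPDFReal n r (n / r * y) =
      devianceWeight n y * (stirlingRatio n * (√(2 * halfDeviance y) / |y - 1|)) := by
  have hn0 : (0 : ℝ) < n := by exact_mod_cast hn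
  have hA : 0 < √(2 * halfDeviance y) :=
    Real.sqrt_pos.2 (mul_pos two_pos (halfDeviance_pos hy h1))
  have hu : 0 < |y - 1| := abs_pos.2 (sub_ne_zero.2 h1)
  have habs : |1 - 1 / y| = |y - 1| / y := by
    rw [← abs_of_pos hy, ← abs_div, abs_of_pos hy, sub_div, div_self hy.ne']
  have hexp : Real.exp (-(n * halfDeviance y)) = Real.exp (-(n * y)) * Real.exp 1 ^ n * y ^ n := by
    rw [← Real.exp_nat_mul]
    nth_rw 3 [← Real.exp_log hy]
    rw [← Real.exp_nat_mul, ← Real.exp_add, ← Real.exp_add, halfDeviance]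
    ring_nf
  obtain ⟨m, rfl⟩ : ∃ m, n = m + 1 := ⟨n - 1, by omega⟩
  have hsq : √(((m + 1 : ℕ) : ℝ) / (2 * Real.pi)) * √(2 * Real.pi * ((m + 1 : ℕ) : ℝ)) =
      ((m + 1 : ℕ) : ℝ) := by
    rw [← Real.sqrt_mul (by positivity), show ((m + 1 : ℕ) : ℝ) / (2 * Real.pi) *
      (2 * Real.pi * ((m + 1 : ℕ) : ℝ)) = ((m + 1 : ℕ) : ℝ) ^ 2 by field_simp,
      Real.sqrt_sq hn0.le]
  rw [gammaPDFReal, if_pos (by positivity), Real.rpow_natCast,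
    show ((m + 1 : ℕ) : ℝ) - 1 = (m : ℕ) by push_cast; ring, Real.rpow_natCast,
    show r * (((m + 1 : ℕ) : ℝ) / r * y) = ((m + 1 : ℕ) : ℝ) * y by field_simp,
    show Real.Gamma ((m + 1 : ℕ) : ℝ) = m.factorial by
      push_cast; exact Real.Gamma_nat_eq_factorial m]
  rw [devianceWeight, stirlingRatio, habs, hexp]
  calc _ = ((m + 1 : ℕ) : ℝ) ^ (m + 1) * y ^ m * Real.exp (-(((m + 1 : ℕ) : ℝ) * y)) /
        m.factorial := by
        rw [mul_pow, div_pow, pow_succ r, pow_succ ((m + 1 : ℕ) : ℝ)]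
        field_simp
    _ = (√(((m + 1 : ℕ) : ℝ) / (2 * Real.pi)) * √(2 * Real.pi * ((m + 1 : ℕ) : ℝ))) *
        (((m + 1 : ℕ) : ℝ) ^ (m + 1) * y ^ m * Real.exp (-(((m + 1 : ℕ) : ℝ) * y)) /
        (m + 1).factorial) := by
        rw [hsq, Nat.factorial_succ]
        push_cast
        field_simp
    _ = _ := by
        rw [div_pow, pow_succ y]
        field_simp

/-- Division by the mean n/r removes the rate, so the resulting law depends on n only. -/
lemma map_gammaMeasure_div {n : ℕ} (hn : 1 ≤ n) {r : ℝ} (hr : 0 < r) :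
    (gammaMeasure n r).map (fun s => s / (n / r)) =
      (devianceLaw n).withDensity fun y =>
        ENNReal.ofReal (stirlingRatio n * (√(2 * halfDeviance y) / |y - 1|)) := by
  have hn0 : (0 : ℝ) < n := by exact_mod_cast hn
  have hc : (0 : ℝ) < n / r := by positivity
  have hm := measurable_halfDeviance
  have hw := measurable_devianceWeight n
  have hg : Measurable (gammaPDF n r) := (measurable_gammaPDFReal n r).ennreal_ofReal
  refine Measure.ext_of_lintegral _ fun F hF => ?_
  rw [lintegral_map hF (by fun_prop), gammaMeasure,
    lintegral_withDensity_eq_lintegral_mul _ hg (by fun_prop),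
    lintegral_withDensity_eq_lintegral_mul _ (by fun_prop) hF, devianceLaw,
    lintegral_withDensity_eq_lintegral_mul _ (by fun_prop) (by fun_prop),
    ← lintegral_add_compl _ measurableSet_Iio (A := Set.Iio 0), Set.compl_Iio,
    setLIntegral_congr Ioi_ae_eq_Ici.symm]
  have h0 : ∫⁻ x in Set.Iio 0, (gammaPDF n r * fun s => F (s / (n / r))) x = 0 := by
    rw [setLIntegral_congr_fun (g := fun _ => 0) measurableSet_Iio, lintegral_zero]
    intro x (hx : x < 0)
    simp [gammaPDF_of_neg hx]
  have himg : (fun y => (n / r) * y) '' Set.Ioi 0 = Set.Ioi (0 : ℝ) := by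
    rw [Set.image_const_mul_Ioi_zero hc]
  rw [h0, zero_add]
  nth_rw 1 [← himg]
  rw [lintegral_image_eq_lintegral_deriv_mul_of_monotoneOn (f := fun y => (n / r) * y)
    (f' := fun _ => n / r) measurableSet_Ioi
    (fun y _ => by simpa using ((hasDerivAt_id y).const_mul ((n : ℝ) / r)).hasDerivWithinAt)
    (fun y _ z _ hyz => mul_le_mul_of_nonneg_left hyz hc.le)]
  refine lintegral_congr_ae ?_
  filter_upwards [ae_restrict_mem measurableSet_Ioi,
    ae_restrict_of_ae (Measure.ae_ne volume (1 : ℝ))] with y (hy : 0 < y) h1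
  simp only [Pi.mul_apply, gammaPDF]
  rw [← mul_assoc, ← mul_assoc, ← ENNReal.ofReal_mul hc.le,
    ← ENNReal.ofReal_mul (devianceWeight_nonneg _ _), mul_gammaPDFReal_mul hn hr hy h1,
    mul_div_cancel_left₀ _ hc.ne']

/-- Comparison of a law with density `k * ρ` close to one with the reference law, for a
function `H` of at most linear growth in `G`. -/
lemma abs_integral_withDensity_sub_le {α : Type*} [MeasurableSpace α] {ν : Measure α}
    [IsProbabilityMeasure ν] {k δ L m₂ : ℝ} (hk0 : 0 ≤ k) (hk1 : k ≤ 1) (hδ : 0 ≤ δ)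
    {ρ G H : α → ℝ} (hρ : Measurable ρ) (hρ0 : ∀ x, 0 ≤ ρ x)
    (hH : Measurable H) (hG0 : ∀ᵐ x ∂ν, 0 ≤ G x) (hbound : ∀ᵐ x ∂ν, |ρ x - 1| ≤ δ * √(G x))
    (hG1 : Integrable G ν) (hG2 : Integrable (fun x => G x ^ 2) ν)
    (hm1 : ∫ x, G x ∂ν = 1) (hm2 : ∫ x, G x ^ 2 ∂ν = m₂)
    (hP : IsProbabilityMeasure (ν.withDensity fun x => ENNReal.ofReal (k * ρ x)))
    {h₀ C : ℝ} (hC : ∀ x, |H x| ≤ C) (hL : ∀ᵐ x ∂ν, |H x - h₀| ≤ L * G x) :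
    |∫ x, H x ∂(ν.withDensity fun x => ENNReal.ofReal (k * ρ x)) - ∫ x, H x ∂ν| ≤
      L * δ * ((3 + m₂) / 2) := by
  have hkρ : ∀ x, 0 ≤ k * ρ x := fun x => mul_nonneg hk0 (hρ0 x)
  -- Replacing √G by (1 + G)/2 means that only the integer moments of G enter.
  have hsqrt : ∀ g : ℝ, 0 ≤ g → √g ≤ (1 + g) / 2 := fun g hg => by
    nlinarith [Real.sq_sqrt hg, sq_nonneg (√g - 1)]
  have hint : ∀ f : α → ℝ, ∫ x, f x ∂(ν.withDensity fun x => ENNReal.ofReal (k * ρ x)) =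
      ∫ x, k * ρ x * f x ∂ν := fun f => by
    rw [integral_withDensity_eq_integral_toReal_smul (by fun_prop)
      (Filter.Eventually.of_forall fun _ => ENNReal.ofReal_lt_top)]
    simp [ENNReal.toReal_ofReal (hkρ _)]
  have hiρ : Integrable ρ ν := by
    refine Integrable.mono' (g := fun x => 1 + δ * ((1 + G x) / 2)) (by fun_prop)
      hρ.aestronglyMeasurable ?_
    filter_upwards [hG0, hbound] with x h1 h2
    rw [Real.norm_eq_abs, abs_of_nonneg (hρ0 x)]
    have := mul_le_mul_of_nonneg_left (hsqrt _ h1) hδ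
    linarith [(abs_le.1 h2).2]
  have hone : k * ∫ x, ρ x ∂ν = 1 := by
    have := hint fun _ => 1
    simpa [integral_const_mul] using this.symm
  have hρm : ∫ x, ρ x ∂ν ≤ 1 + δ := by
    calc ∫ x, ρ x ∂ν ≤ ∫ x, (1 + δ * ((1 + G x) / 2)) ∂ν := by
          refine integral_mono_ae hiρ (by fun_prop) ?_
          filter_upwards [hG0, hbound] with x h1 h2
          have := mul_le_mul_of_nonneg_left (hsqrt _ h1) hδ
          linarith [(abs_le.1 h2).2]
      _ = 1 + δ := by
          rw [integral_add (by fun_prop) (by fun_prop), integral_const_mul, integral_div,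
            integral_add (by fun_prop) hG1, hm1]
          simp
  -- Normalisation bounds k from below: 1 = k∫ρ ≤ k(1 + δ). A quantitative Stirling estimate is
  -- therefore unnecessary; only k ≤ 1 is taken from outside.
  have hk : 1 - k ≤ δ := by
    have : 1 ≤ k * (1 + δ) := by
      have := mul_le_mul_of_nonneg_left hρm hk0
      rwa [hone] at this
    nlinarith
  have hHi : Integrable H ν := Integrable.of_bound hH.aestronglyMeasurable C
    (Filter.Eventually.of_forall hC)
  have hHi' : Integrable (fun x => k * ρ x * H x) ν :=
    (hiρ.const_mul k).mul_bdd (c := C) hH.aestronglyMeasurable (Filter.Eventually.of_forall hC)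
  have hkρi : Integrable (fun x => k * ρ x) ν := hiρ.const_mul k
  -- Since kρ - 1 has integral zero, the constant `h₀` can be subtracted from H.
  have hdiff : ∫ x, H x ∂(ν.withDensity fun x => ENNReal.ofReal (k * ρ x)) - ∫ x, H x ∂ν =
      ∫ x, (k * ρ x - 1) * (H x - h₀) ∂ν := by
    have e : ∀ x, (k * ρ x - 1) * (H x - h₀) = (k * ρ x * H x - H x) - h₀ * (k * ρ x - 1) :=
      fun x => by ring
    simp_rw [e]
    rw [integral_sub (f := fun x => k * ρ x * H x - H x) (g := fun x => h₀ * (k * ρ x - 1))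
        (hHi'.sub hHi) ((hkρi.sub (integrable_const 1)).const_mul _),
      integral_sub hHi' hHi, integral_const_mul, integral_sub hkρi (integrable_const 1),
      integral_const_mul, hone, hint]
    simp
  rw [hdiff]
  calc |∫ x, (k * ρ x - 1) * (H x - h₀) ∂ν|
      ≤ ∫ x, L * δ * ((3 / 2) * G x + (1 / 2) * G x ^ 2) ∂ν := by
        refine norm_integral_le_of_norm_le (f := fun x => (k * ρ x - 1) * (H x - h₀))
          (by fun_prop) ?_
        filter_upwards [hG0, hbound, hL] with x h1 h2 h3
        rw [Real.norm_eq_abs, abs_mul]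
        -- The bound is the sum of δ(1 + G)/2 from ρ - 1 and δ from 1 - k.
        have h4 : |k * ρ x - 1| ≤ δ * ((3 + G x) / 2) := by
          have e : k * ρ x - 1 = k * (ρ x - 1) + -(1 - k) := by ring
          rw [e]
          refine (abs_add_le _ _).trans ?_
          rw [abs_neg, abs_of_nonneg (sub_nonneg.2 hk1), abs_mul, abs_of_nonneg hk0]
          have h5 : k * |ρ x - 1| ≤ 1 * |ρ x - 1| :=
            mul_le_mul_of_nonneg_right hk1 (abs_nonneg _)
          have := mul_le_mul_of_nonneg_left (hsqrt _ h1) hδ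
          linarith
        calc |k * ρ x - 1| * |H x - h₀| ≤ (δ * ((3 + G x) / 2)) * (L * G x) :=
              mul_le_mul h4 h3 (abs_nonneg _) (by positivity)
          _ = _ := by ring
    _ = L * δ * ((3 + m₂) / 2) := by
        rw [integral_const_mul, integral_add (hG1.const_mul _) (hG2.const_mul _),
          integral_const_mul, integral_const_mul, hm1, hm2]
        ring

lemma abs_integral_deviance_gamma_sub_le {n : ℕ} (hn : 1 ≤ n) {r : ℝ} (hr : 0 < r)
    {h : ℝ → ℝ} (hh : Measurable h) {C L : ℝ} (hC : ∀ x, |h x| ≤ C)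
    (hL : ∀ t, |h t - h 0| ≤ L * |t|) :
    |∫ s, h (2 * n * halfDeviance (s / (n / r))) ∂gammaMeasure n r -
        ∫ z, h (z ^ 2) ∂gaussianReal 0 1| ≤ 3 * L / √(n : ℝ) := by
  have hn0 : (0 : ℝ) < n := by exact_mod_cast hn
  have hm := measurable_halfDeviance
  have := isProbabilityMeasure_devianceLaw hn0
  have hmap := map_gammaMeasure_div hn hr
  have hP : IsProbabilityMeasure ((devianceLaw n).withDensity fun y =>
      ENNReal.ofReal (stirlingRatio n * (√(2 * halfDeviance y) / |y - 1|))) := by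
    have := isProbabilityMeasure_gammaMeasure hn0 hr
    rw [← hmap]
    exact Measure.isProbabilityMeasure_map (by fun_prop)
  rw [← integral_map (φ := fun s => s / (n / r)) (f := fun y => h (2 * n * halfDeviance y))
      (by fun_prop) (hh.comp (hm.const_mul _)).aestronglyMeasurable, hmap, ← integral_devianceLaw hn0 hh]
  have i1 := integrable_devianceLaw hn0 (F := fun t => t) (by fun_prop)
    (integrable_pow_gaussianReal 2)
  have i2 := integrable_devianceLaw hn0 (F := fun t => t ^ 2) (by fun_prop)
    (by simpa only [← pow_mul] using integrable_pow_gaussianReal 4)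
  have m1 := integral_devianceLaw hn0 (F := fun t => t) (by fun_prop)
  have m2 := integral_devianceLaw hn0 (F := fun t => t ^ 2) (by fun_prop)
  simp only [← pow_mul] at m2
  rw [integral_sq_gaussianReal] at m1
  rw [integral_pow_four_gaussianReal] at m2
  have hG0 : ∀ᵐ y ∂devianceLaw n, 0 ≤ 2 * n * halfDeviance y := by
    filter_upwards [ae_devianceLaw n] with y hy
    have := halfDeviance_nonneg hy.1
    positivity
  -- Here √(2D) = √G/√n gives δ, and the fourth Gaussian moment turns (3 + m₂)/2 into 3.
  refine (abs_integral_withDensity_sub_le (δ := 1 / √(n : ℝ)) (L := L) (h₀ := h 0)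
    (G := fun y => 2 * n * halfDeviance y) (stirlingRatio_nonneg n) (stirlingRatio_le_one n)
    (by positivity) (by fun_prop) (fun y => by positivity) (by fun_prop) hG0 ?_
    i1 i2 m1 m2 hP (fun y => hC _) ?_).trans (le_of_eq ?_)
  · filter_upwards [ae_devianceLaw n] with y hy
    have := abs_sqrt_halfDeviance_div_sub_one_le hy.1 hy.2
    refine this.trans (le_of_eq ?_)
    rw [show 2 * (n : ℝ) * halfDeviance y = n * (2 * halfDeviance y) by ring,
      Real.sqrt_mul hn0.le]
    field_simp
  · filter_upwards [hG0] with y hy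
    have := hL (2 * n * halfDeviance y)
    rwa [abs_of_nonneg hy] at this
  · ring

/-! ### Sums of independent exponentials. -/

/-- For x > 0 the integrand lives on [0, x], where the two exponentials combine to the constant
exp(-rx) and a monomial is left to integrate. -/
lemma gammaPDF_lconvolution_exponentialPDF {k : ℕ} (hk : 1 ≤ k) {r x : ℝ} (hr : 0 < r)
    (hx : x ≠ 0) :
    lconvolution (gammaPDF k r) (gammaPDF 1 r) volume x = gammaPDF (k + 1 : ℕ) r x := by
  rw [lconvolution_def]
  rcases lt_or_gt_of_ne hx with h | h
  · rw [gammaPDF_of_neg h, lintegral_eq_zero_iff' (by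
      have := measurable_gammaPDFReal k r
      have := measurable_gammaPDFReal 1 r
      unfold gammaPDF
      fun_prop)]
    refine Filter.Eventually.of_forall fun y => ?_
    rcases lt_or_ge y 0 with hy | hy
    · simp [gammaPDF_of_neg hy]
    · simp [gammaPDF_of_neg (show -y + x < 0 by linarith)]
  · obtain ⟨m, rfl⟩ : ∃ m, k = m + 1 := ⟨k - 1, by omega⟩
    set c : ℝ := r ^ (m + 2) / m.factorial * Real.exp (-(r * x)) with hc
    have hc0 : 0 ≤ c := by positivity
    have e : ∀ y, gammaPDF (m + 1 : ℕ) r y * gammaPDF 1 r (-y + x) =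
        (Set.Icc 0 x).indicator (fun y => ENNReal.ofReal (c * y ^ m)) y := by
      intro y
      by_cases hy : y ∈ Set.Icc 0 x
      · rw [Set.indicator_of_mem hy, gammaPDF_of_nonneg hy.1,
          gammaPDF_of_nonneg (by linarith [hy.2]), ← ENNReal.ofReal_mul (by
            have := hy.1
            have := Real.Gamma_nonneg_of_nonneg (s := ((m + 1 : ℕ) : ℝ)) (by positivity)
            positivity)]
        congr 1
        rw [show Real.Gamma ((m + 1 : ℕ) : ℝ) = m.factorial by
            push_cast; exact Real.Gamma_nat_eq_factorial m,
          show ((m + 1 : ℕ) : ℝ) - 1 = (m : ℕ) by push_cast; ring, Real.rpow_natCast,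
          Real.rpow_natCast, hc, show -(r * x) = -(r * y) + -(r * (-y + x)) by ring, Real.exp_add]
        simp
        ring
      · rw [Set.indicator_of_notMem hy]
        rcases lt_or_ge y 0 with h0 | h0
        · simp [gammaPDF_of_neg h0]
        · have : -y + x < 0 := by
            by_contra hcon
            exact hy ⟨h0, by linarith⟩
          simp [gammaPDF_of_neg this]
    simp_rw [e]
    rw [lintegral_indicator measurableSet_Icc, ← ofReal_integral_eq_lintegral_ofReal
      ((by fun_prop : Continuous fun y : ℝ => c * y ^ m).continuousOn.integrableOn_Icc)
      (by
        filter_upwards [ae_restrict_mem measurableSet_Icc] with y hy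
        exact mul_nonneg hc0 (pow_nonneg hy.1 _)),
      integral_Icc_eq_integral_Ioc, ← intervalIntegral.integral_of_le h.le,
      intervalIntegral.integral_const_mul, integral_pow, gammaPDF_of_nonneg h.le]
    congr 1
    rw [show Real.Gamma ((m + 1 + 1 : ℕ) : ℝ) = (m + 1).factorial by
        rw [Nat.cast_succ]; exact Real.Gamma_nat_eq_factorial (m + 1),
      show ((m + 1 + 1 : ℕ) : ℝ) - 1 = (m + 1 : ℕ) by push_cast; ring, Real.rpow_natCast,
      Real.rpow_natCast, hc, Nat.factorial_succ]
    push_cast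
    simp
    field_simp

lemma gammaMeasure_conv_expMeasure {k : ℕ} (hk : 1 ≤ k) {r : ℝ} (hr : 0 < r) :
    (gammaMeasure k r).conv (expMeasure r) = gammaMeasure (k + 1 : ℕ) r := by
  have hm : ∀ a, Measurable (gammaPDF a r) := fun a => (measurable_gammaPDFReal a r).ennreal_ofReal
  rw [expMeasure, gammaMeasure, gammaMeasure, gammaMeasure,
    conv_withDensity_eq_lconvolution (hm _) (hm _)]
  refine withDensity_congr_ae ?_
  filter_upwards [Measure.ae_ne volume (0 : ℝ)] with x hx
  exact gammaPDF_lconvolution_exponentialPDF hk hr hx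

lemma hasLaw_sum_gammaMeasure {ι Ω : Type*} [MeasurableSpace Ω] {P : Measure Ω}
    [IsProbabilityMeasure P] {r : ℝ} (hr : 0 < r) {X : ι → Ω → ℝ}
    (hX : ∀ i, HasLaw (X i) (expMeasure r) P) (hind : iIndepFun X P) {s : Finset ι}
    (hs : s.Nonempty) : HasLaw (∑ i ∈ s, X i) (gammaMeasure s.card r) P := by
  classical
  induction hs using Finset.Nonempty.cons_induction with
  | singleton a => simpa [expMeasure] using hX a
  | cons a s ha hs ih =>
    have := isProbabilityMeasure_expMeasure hr
    have := isProbabilityMeasure_gammaMeasure (a := s.card) (by exact_mod_cast hs.card_pos) hr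
    have hi := hind.indepFun_finsetSum_of_notMem₀ (fun i => (hX i).aemeasurable) ha
    rw [Finset.sum_cons, add_comm, Finset.card_cons,
      ← gammaMeasure_conv_expMeasure hs.card_pos hr]
    exact hi.hasLaw_add ih (hX a)

/-! ### The exponential model: moments, derivatives of the log-likelihood, the maximiser. -/

lemma expModel_f_of_pos (θ : ℝ) {x : ℝ} (hx : 0 < x) :
    expModel.f θ x = 1 / θ * Real.exp (-(1 / θ) * x) := if_pos hx

lemma support_expModel : expModel.support = Set.Ioi 0 := by
  ext x
  simp only [ParamModel.support, Set.mem_ofPred_eq, Set.mem_Ioi]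
  constructor
  · rintro ⟨θ, _, h⟩
    by_contra hx
    simp [expModel, hx] at h
  · exact fun hx => ⟨1, Set.mem_Ioi.2 one_pos, by rw [expModel_f_of_pos 1 hx]; positivity⟩

lemma mem_sampleSupport_expModel {n : ℕ} {x : Fin n → ℝ} :
    x ∈ expModel.sampleSupport n ↔ ∀ i, 0 < x i := by
  simp [ParamModel.sampleSupport, support_expModel]

lemma measurable_expModel_f (θ : ℝ) : Measurable (expModel.f θ) :=
  Measurable.ite measurableSet_Ioi (by fun_prop) measurable_const

lemma expModel_f_nonneg {θ : ℝ} (hθ : 0 < θ) (x : ℝ) : 0 ≤ expModel.f θ x := by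
  simp only [expModel]
  split_ifs <;> positivity

lemma law_expModel (θ : ℝ) : expModel.law θ = expMeasure (1 / θ) := by
  rw [ParamModel.law, expMeasure, gammaMeasure]
  refine withDensity_congr_ae ?_
  -- The two densities differ at 0, which is a null set.
  filter_upwards [Measure.ae_ne volume (0 : ℝ)] with x hx
  rcases lt_or_gt_of_ne hx with h | h
  · rw [gammaPDF_of_neg h]
    simp [expModel, not_lt.2 h.le]
  · rw [gammaPDF_of_nonneg h.le, expModel_f_of_pos θ h]
    simp

lemma isProbabilityMeasure_law_expModel {θ : ℝ} (hθ : 0 < θ) :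
    IsProbabilityMeasure (expModel.law θ) := by
  rw [law_expModel]
  exact isProbabilityMeasure_expMeasure (by positivity)

lemma ae_law_expModel_pos (θ : ℝ) : ∀ᵐ x ∂expModel.law θ, 0 < x := by
  rw [ParamModel.law, ae_withDensity_iff (measurable_expModel_f θ).ennreal_ofReal]
  refine Filter.Eventually.of_forall fun x hx => ?_
  by_contra h
  simp [expModel, h] at hx

lemma ae_sampleLaw_expModel_pos (n : ℕ) {θ : ℝ} (hθ : 0 < θ) :
    ∀ᵐ x ∂expModel.sampleLaw n θ, ∀ i, 0 < x i := by
  have := isProbabilityMeasure_law_expModel hθ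
  rw [ae_all_iff]
  intro i
  exact (measurePreserving_eval (fun _ : Fin n => expModel.law θ)
    i).quasiMeasurePreserving.ae (ae_law_expModel_pos θ)

/-- Real exponents, including the exponent 1, match the form of the gamma integral used for all
moments. -/
lemma pow_mul_expModel_f (θ : ℝ) (k : ℕ) :
    (fun x => x ^ k * expModel.f θ x) = (Set.Ioi 0).indicator
      fun x => 1 / θ * (x ^ (k : ℝ) * Real.exp (-(1 / θ) * x ^ (1 : ℝ))) := by
  ext x
  by_cases hx : 0 < x
  · rw [Set.indicator_of_mem (Set.mem_Ioi.2 hx), expModel_f_of_pos θ hx, Real.rpow_natCast,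
      Real.rpow_one]
    ring
  · rw [Set.indicator_of_notMem (by simpa using hx)]
    simp [expModel, hx]

lemma integrable_pow_law_expModel {θ : ℝ} (hθ : 0 < θ) (k : ℕ) :
    Integrable (fun x => x ^ k) (expModel.law θ) := by
  rw [ParamModel.law, integrable_withDensity_iff (measurable_expModel_f θ).ennreal_ofReal
    (Filter.Eventually.of_forall fun _ => ENNReal.ofReal_lt_top)]
  simp_rw [ENNReal.toReal_ofReal (expModel_f_nonneg hθ _)]
  rw [pow_mul_expModel_f, integrable_indicator_iff measurableSet_Ioi]
  exact (integrableOn_rpow_mul_exp_neg_mul_rpow (by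
    have : (0 : ℝ) ≤ k := k.cast_nonneg
    linarith) one_pos (by positivity)).const_mul _

lemma integral_pow_law_expModel {θ : ℝ} (hθ : 0 < θ) (k : ℕ) :
    ∫ x, x ^ k ∂expModel.law θ = k.factorial * θ ^ k := by
  rw [ParamModel.law, integral_withDensity_eq_integral_toReal_smul
    (measurable_expModel_f θ).ennreal_ofReal
    (Filter.Eventually.of_forall fun _ => ENNReal.ofReal_lt_top)]
  simp_rw [ENNReal.toReal_ofReal (expModel_f_nonneg hθ _), smul_eq_mul, mul_comm (expModel.f θ _)]
  rw [pow_mul_expModel_f, integral_indicator measurableSet_Ioi, integral_const_mul,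
    integral_rpow_mul_exp_neg_mul_rpow one_pos (by
      have : (0 : ℝ) ≤ k := k.cast_nonneg
      linarith) (by positivity), div_one, div_one, div_one, Real.Gamma_nat_eq_factorial, one_div,
    Real.inv_rpow hθ.le, ← Real.rpow_neg hθ.le, neg_neg, ← Nat.cast_succ, Real.rpow_natCast, pow_succ]
  field_simp

lemma integral_id_law_expModel {θ : ℝ} (hθ : 0 < θ) : ∫ x, x ∂expModel.law θ = θ := by
  simpa using integral_pow_law_expModel hθ 1

lemma integrable_id_law_expModel {θ : ℝ} (hθ : 0 < θ) :
    Integrable (fun x => x) (expModel.law θ) := by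
  simpa using integrable_pow_law_expModel hθ 1

lemma lik_expModel_pos {n : ℕ} {x : Fin n → ℝ} (hx : ∀ i, 0 < x i) {θ : ℝ} (hθ : 0 < θ) :
    0 < expModel.lik θ x := by
  refine Finset.prod_pos fun i _ => ?_
  rw [expModel_f_of_pos θ (hx i)]
  positivity

lemma log_expModel_f {θ x : ℝ} (hθ : 0 < θ) (hx : 0 < x) :
    Real.log (expModel.f θ x) = -Real.log θ - x / θ := by
  rw [expModel_f_of_pos θ hx, Real.log_mul (by positivity) (Real.exp_ne_zero _), Real.log_exp,
    one_div, Real.log_inv]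
  ring

lemma loglik_expModel {n : ℕ} {x : Fin n → ℝ} (hx : ∀ i, 0 < x i) {θ : ℝ} (hθ : 0 < θ) :
    expModel.loglik θ x = -(n * Real.log θ) - (∑ i, x i) / θ := by
  rw [ParamModel.loglik, ParamModel.lik, Real.log_prod]
  · simp_rw [log_expModel_f hθ (hx _)]
    rw [Finset.sum_sub_distrib, Finset.sum_div]
    simp
  · intro i _
    rw [expModel_f_of_pos θ (hx i)]
    positivity

lemma score_expModel {θ x : ℝ} (hθ : 0 < θ) (hx : 0 < x) :
    expModel.score θ x = -(1 / θ) + x / θ ^ 2 := by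
  have h : (fun t => Real.log (expModel.f t x)) =ᶠ[nhds θ] fun t => -Real.log t - x / t := by
    filter_upwards [Ioi_mem_nhds hθ] with t ht
    exact log_expModel_f ht hx
  rw [ParamModel.score, h.deriv_eq]
  have := ((Real.hasDerivAt_log hθ.ne').neg).sub ((hasDerivAt_inv hθ.ne').const_mul x)
  have := this.deriv
  convert! this using 1
  field_simp
  ring

lemma deriv_loglik_expModel {n : ℕ} {x : Fin n → ℝ} (hx : ∀ i, 0 < x i) {θ : ℝ} (hθ : 0 < θ) :
    deriv (fun t => expModel.loglik t x) θ = -(n / θ) + (∑ i, x i) / θ ^ 2 := by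
  have h : (fun t => expModel.loglik t x) =ᶠ[nhds θ]
      fun t => -(n * Real.log t) - (∑ i, x i) / t := by
    filter_upwards [Ioi_mem_nhds hθ] with t ht
    exact loglik_expModel hx ht
  rw [h.deriv_eq]
  have := (((Real.hasDerivAt_log hθ.ne').const_mul (n : ℝ)).neg).sub
    ((hasDerivAt_inv hθ.ne').const_mul (∑ i, x i))
  have := this.deriv
  convert! this using 1
  field_simp
  ring

lemma iteratedDeriv_two_loglik_expModel {n : ℕ} {x : Fin n → ℝ} (hx : ∀ i, 0 < x i) {θ : ℝ}
    (hθ : 0 < θ) :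
    iteratedDeriv 2 (fun t => expModel.loglik t x) θ = n / θ ^ 2 - 2 * (∑ i, x i) / θ ^ 3 := by
  have h : deriv (fun t => expModel.loglik t x) =ᶠ[nhds θ]
      fun t => -(n / t) + (∑ i, x i) / t ^ 2 := by
    filter_upwards [Ioi_mem_nhds hθ] with t ht
    exact deriv_loglik_expModel hx ht
  rw [iteratedDeriv_succ, iteratedDeriv_one, h.deriv_eq]
  have := (((hasDerivAt_inv hθ.ne').const_mul (n : ℝ)).neg).add
    ((((hasDerivAt_id θ).pow 2).inv (pow_ne_zero 2 hθ.ne')).const_mul (∑ i, x i))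
  have := this.deriv
  convert! this using 1
  simp
  field_simp
  ring

lemma iteratedDeriv_three_loglik_expModel {n : ℕ} {x : Fin n → ℝ} (hx : ∀ i, 0 < x i) {θ : ℝ}
    (hθ : 0 < θ) :
    iteratedDeriv 3 (fun t => expModel.loglik t x) θ =
      -(2 * n / θ ^ 3) + 6 * (∑ i, x i) / θ ^ 4 := by
  have h : iteratedDeriv 2 (fun t => expModel.loglik t x) =ᶠ[nhds θ]
      fun t => n / t ^ 2 - 2 * (∑ i, x i) / t ^ 3 := by
    filter_upwards [Ioi_mem_nhds hθ] with t ht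
    exact iteratedDeriv_two_loglik_expModel hx ht
  rw [iteratedDeriv_succ, h.deriv_eq]
  have := ((((hasDerivAt_id θ).pow 2).inv (pow_ne_zero 2 hθ.ne')).const_mul (n : ℝ)).sub
    ((((hasDerivAt_id θ).pow 3).inv (pow_ne_zero 3 hθ.ne')).const_mul (2 * ∑ i, x i))
  have := this.deriv
  convert! this using 1
  simp
  field_simp
  ring

lemma sampleMean_pos {n : ℕ} (hn : 1 ≤ n) {x : Fin n → ℝ} (hx : ∀ i, 0 < x i) :
    0 < sampleMean x := by
  have : Nonempty (Fin n) := ⟨⟨0, hn⟩⟩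
  have h0 : (0 : ℝ) < n := by exact_mod_cast hn
  exact div_pos (Finset.sum_pos (fun i _ => hx i) Finset.univ_nonempty) h0

/-- This exact identity serves twice: it identifies the maximiser, as the right side is nonnegative
and vanishes only when `θ` is the sample mean, and it expresses the Wilks statistic through the sum
of the observations. -/
lemma loglik_sampleMean_sub {n : ℕ} (hn : 1 ≤ n) {x : Fin n → ℝ} (hx : ∀ i, 0 < x i) {θ : ℝ}
    (hθ : 0 < θ) :
    expModel.loglik (sampleMean x) x - expModel.loglik θ x =
      n * halfDeviance (sampleMean x / θ) := by
  have h0 : (0 : ℝ) < n := by exact_mod_cast hn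
  have hm := sampleMean_pos hn hx
  have hs : ∑ i, x i = n * sampleMean x := by rw [sampleMean]; field_simp
  rw [loglik_expModel hx hm, loglik_expModel hx hθ, halfDeviance, Real.log_div hm.ne' hθ.ne', hs]
  field_simp
  ring

lemma isMLE_expModel_iff {n : ℕ} (hn : 1 ≤ n) {x : Fin n → ℝ} (hx : ∀ i, 0 < x i) (θ : ℝ) :
    expModel.IsMLE x θ ↔ θ = sampleMean x := by
  have h0 : (0 : ℝ) < n := by exact_mod_cast hn
  have hm := sampleMean_pos hn hx
  constructor
  · rintro ⟨hθ : 0 < θ, h⟩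
    have h1 := Real.log_le_log (lik_expModel_pos hx hm) (h _ hm)
    have h2 := loglik_sampleMean_sub hn hx hθ
    simp only [ParamModel.loglik] at h2
    by_contra hne
    have := mul_pos h0 (halfDeviance_pos (div_pos hm hθ)
      (fun he => hne ((div_eq_one_iff_eq hθ.ne').1 he).symm))
    linarith
  · rintro rfl
    refine ⟨hm, fun θ (hθ : 0 < θ) => ?_⟩
    have h2 := loglik_sampleMean_sub hn hx hθ
    simp only [ParamModel.loglik] at h2
    have := mul_nonneg h0.le (halfDeviance_nonneg (div_pos hm hθ))
    exact (Real.log_le_log_iff (lik_expModel_pos hx hθ) (lik_expModel_pos hx hm)).1 (by linarith)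

/-! ### The regularity conditions. -/

/-- The parameter is the mean, so it is determined by the law. -/
lemma rc1_expModel : expModel.RC1 := by
  intro θ (hθ : 0 < θ) θ' (hθ' : 0 < θ') hne h
  apply hne
  rw [← integral_id_law_expModel hθ, ← integral_id_law_expModel hθ']
  congr 1
  refine withDensity_congr_ae ?_
  filter_upwards [h] with x hx
  rw [hx]

lemma rc2_expModel (n : ℕ) : expModel.RC2 n := by
  refine ⟨isOpen_Ioi, fun x hx => ?_⟩
  rw [mem_sampleSupport_expModel] at hx
  have h : ContDiffOn ℝ 3 (fun θ : ℝ => -(n * Real.log θ) - (∑ i, x i) / θ) (Set.Ioi 0) := by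
    intro θ hθ
    have hθ' : θ ≠ 0 := (Set.mem_Ioi.1 hθ).ne'
    exact (((contDiffAt_const.mul (Real.contDiffAt_log.2 hθ')).neg).sub
      (contDiffAt_const.div contDiffAt_id hθ')).contDiffWithinAt
  exact h.congr fun θ hθ => loglik_expModel hx hθ

lemma integrable_eval_sampleLaw_expModel {n : ℕ} {θ : ℝ} (hθ : 0 < θ) (i : Fin n) :
    Integrable (fun x => x i) (expModel.sampleLaw n θ) := by
  have := isProbabilityMeasure_law_expModel hθ
  exact (measurePreserving_eval (fun _ : Fin n => expModel.law θ)
    i).integrable_comp_of_integrable (integrable_id_law_expModel hθ)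

lemma integral_eval_sampleLaw_expModel {n : ℕ} {θ : ℝ} (hθ : 0 < θ) (i : Fin n) :
    ∫ x, x i ∂expModel.sampleLaw n θ = θ := by
  have := isProbabilityMeasure_law_expModel hθ
  have h := measurePreserving_eval (fun _ : Fin n => expModel.law θ) i
  have h2 := integral_map (μ := Measure.pi fun _ : Fin n => expModel.law θ) (f := fun y : ℝ => y)
    h.measurable.aemeasurable (by fun_prop)
  rw [h.map_eq, integral_id_law_expModel hθ] at h2
  exact h2.symm

/-- A bound for the third derivative of the log-likelihood on `(θ₀ / 2, 3 θ₀ / 2)`. -/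
noncomputable def thirdDerivMajorant (n : ℕ) (θ₀ : ℝ) (x : Fin n → ℝ) : ℝ :=
  2 * n / (θ₀ / 2) ^ 3 + 6 * |∑ i, x i| / (θ₀ / 2) ^ 4

lemma thirdDerivBound_expModel (n : ℕ) {θ₀ : ℝ} (hθ₀ : 0 < θ₀) :
    expModel.ThirdDerivBound n θ₀ (θ₀ / 2) (thirdDerivMajorant n θ₀) := by
  have := isProbabilityMeasure_law_expModel hθ₀
  have : IsProbabilityMeasure (expModel.sampleLaw n θ₀) := by
    unfold ParamModel.sampleLaw; infer_instance
  refine ⟨by positivity, fun θ hθ => ?_, ?_⟩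
  -- The radius θ₀/2 keeps θ away from 0, so negative powers of θ are bounded by those of θ₀/2.
  · have hθ1 : θ₀ / 2 < θ := by linarith [(abs_lt.1 hθ).1]
    have hθ2 : 0 < θ := by linarith
    refine ⟨hθ2, fun x hx => ?_⟩
    rw [mem_sampleSupport_expModel] at hx
    rw [iteratedDeriv_three_loglik_expModel hx hθ2, thirdDerivMajorant]
    refine (abs_add_le _ _).trans ?_
    rw [abs_neg, abs_of_nonneg (by positivity : 0 ≤ 2 * (n : ℝ) / θ ^ 3), abs_div, abs_mul,
      abs_of_nonneg (by norm_num : (0 : ℝ) ≤ 6), abs_of_pos (by positivity : 0 < θ ^ 4)]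
    gcongr
  · have h : Integrable (fun x : Fin n → ℝ => ∑ i, x i) (expModel.sampleLaw n θ₀) :=
      integrable_finsetSum _ fun i _ => integrable_eval_sampleLaw_expModel hθ₀ i
    exact (integrable_const _).add ((h.abs.const_mul 6).div_const _)

lemma rc3_expModel (n : ℕ) : expModel.RC3 n := fun _ hθ₀ =>
  ⟨_, _, thirdDerivBound_expModel n hθ₀⟩

lemma integrable_affine_law_expModel {θ : ℝ} (hθ : 0 < θ) :
    Integrable (fun x => -(1 / θ) + x / θ ^ 2) (expModel.law θ) := by
  have := isProbabilityMeasure_law_expModel hθ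
  exact (integrable_const _).add ((integrable_id_law_expModel hθ).div_const _)

lemma integral_affine_law_expModel {θ : ℝ} (hθ : 0 < θ) :
    ∫ x, (-(1 / θ) + x / θ ^ 2) ∂expModel.law θ = 0 := by
  have := isProbabilityMeasure_law_expModel hθ
  rw [integral_add (integrable_const _) ((integrable_id_law_expModel hθ).div_const _),
    integral_div, integral_id_law_expModel hθ]
  simp
  field_simp
  ring

lemma score_expModel_ae {θ : ℝ} (hθ : 0 < θ) :
    expModel.score θ =ᵐ[expModel.law θ] fun x => -(1 / θ) + x / θ ^ 2 := by
  filter_upwards [ae_law_expModel_pos θ] with x hx using score_expModel hθ hx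

lemma rc4_expModel : expModel.RC4 := by
  intro θ (hθ : 0 < θ)
  exact ⟨(integrable_affine_law_expModel hθ).congr (score_expModel_ae hθ).symm,
    by rw [integral_congr_ae (score_expModel_ae hθ), integral_affine_law_expModel hθ]⟩

lemma integrable_abs_affine_pow_law_expModel {θ : ℝ} (hθ : 0 < θ) (k : ℕ) :
    Integrable (fun x => |-(1 / θ) + x / θ ^ 2| ^ k) (expModel.law θ) := by
  have := isProbabilityMeasure_law_expModel hθ
  refine Integrable.mono' (g := fun x => 2 ^ (k - 1) * ((1 / θ) ^ k + |x ^ k| / (θ ^ 2) ^ k)) ?_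
    (by fun_prop) (Filter.Eventually.of_forall fun x => ?_)
  · exact ((integrable_const _).add
      ((integrable_pow_law_expModel hθ k).abs.div_const _)).const_mul _
  · rw [Real.norm_eq_abs, abs_pow, abs_abs]
    refine (pow_le_pow_left₀ (abs_nonneg _) (abs_add_le _ _) k).trans ?_
    refine (add_pow_le (abs_nonneg _) (abs_nonneg _) k).trans (le_of_eq ?_)
    rw [abs_neg, abs_of_pos (by positivity : 0 < 1 / θ), abs_div, div_pow |x|,
      abs_pow x, abs_of_pos (by positivity : 0 < θ ^ 2)]

lemma o3_expModel : expModel.O3 := by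
  intro θ (hθ : 0 < θ) k _
  refine (integrable_abs_affine_pow_law_expModel hθ k).congr ?_
  filter_upwards [score_expModel_ae hθ] with x hx
  rw [hx]

lemma memLp_affine_law_expModel {θ : ℝ} (hθ : 0 < θ) :
    MemLp (fun x => -(1 / θ) + x / θ ^ 2) 2 (expModel.law θ) := by
  rw [memLp_two_iff_integrable_sq (by fun_prop)]
  simpa only [sq_abs] using integrable_abs_affine_pow_law_expModel hθ 2

lemma fisherInfo_expModel {θ : ℝ} (hθ : 0 < θ) : expModel.fisherInfo θ = 1 / θ ^ 2 := by
  have := isProbabilityMeasure_law_expModel hθ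
  have hv : Var[fun x => x; expModel.law θ] = θ ^ 2 := by
    have hm : MemLp (fun x : ℝ => x) 2 (expModel.law θ) :=
      (memLp_two_iff_integrable_sq (by fun_prop)).2 (integrable_pow_law_expModel hθ 2)
    have h2 := integral_pow_law_expModel hθ 2
    have h := variance_eq_sub hm
    simp only [Pi.pow_apply] at h
    rw [h, h2, integral_id_law_expModel hθ, Nat.factorial_two]
    push_cast
    ring
  have h : ∀ᵐ x ∂expModel.law θ, expModel.score θ x ^ 2 = 1 / θ ^ 4 * (x - θ) ^ 2 := by
    filter_upwards [score_expModel_ae hθ] with x hx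
    rw [hx]
    field_simp
    ring
  rw [variance_eq_integral (by fun_prop), integral_id_law_expModel hθ] at hv
  rw [ParamModel.fisherInfo, integral_congr_ae h, integral_const_mul, hv]
  field_simp

/-- Almost surely ℓ' is a sum of n independent centred scores, so its second moment is a variance
and is additive. The identity for ℓ'' needs only the mean, ℓ'' being affine in the sum of the
observations. -/
lemma rc5_expModel (n : ℕ) : expModel.RC5 n := by
  intro θ (hθ : 0 < θ)
  have := isProbabilityMeasure_law_expModel hθ
  have : IsProbabilityMeasure (expModel.sampleLaw n θ) := by
    unfold ParamModel.sampleLaw; infer_instance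
  have hmem := memLp_affine_law_expModel hθ
  set g : ℝ → ℝ := fun x => -(1 / θ) + x / θ ^ 2 with hg
  have hgi (i : Fin n) : MemLp (fun x : Fin n → ℝ => g (x i)) 2 (expModel.sampleLaw n θ) :=
    hmem.comp_measurePreserving (measurePreserving_eval (fun _ : Fin n => expModel.law θ) i)
  have hsum : MemLp (∑ i, fun x : Fin n → ℝ => g (x i)) 2 (expModel.sampleLaw n θ) :=
    memLp_finsetSum' _ fun i _ => hgi i
  have hd : (fun x => deriv (fun t => expModel.loglik t x) θ ^ 2) =ᵐ[expModel.sampleLaw n θ]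
      fun x => (∑ i, fun x : Fin n → ℝ => g (x i)) x ^ 2 := by
    filter_upwards [ae_sampleLaw_expModel_pos n hθ] with x hx
    rw [deriv_loglik_expModel hx hθ, Finset.sum_apply, hg, Finset.sum_add_distrib,
      Finset.sum_div]
    simp [div_eq_mul_inv]
  have hd2 : (fun x => iteratedDeriv 2 (fun t => expModel.loglik t x) θ)
      =ᵐ[expModel.sampleLaw n θ] fun x => n / θ ^ 2 - 2 * (∑ i, x i) / θ ^ 3 := by
    filter_upwards [ae_sampleLaw_expModel_pos n hθ] with x hx
    exact iteratedDeriv_two_loglik_expModel hx hθ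
  have his : Integrable (fun x : Fin n → ℝ => ∑ i, x i) (expModel.sampleLaw n θ) :=
    integrable_finsetSum _ fun i _ => integrable_eval_sampleLaw_expModel hθ i
  have hmean : ∫ x, (∑ i, fun x : Fin n → ℝ => g (x i)) x ∂expModel.sampleLaw n θ = 0 := by
    simp_rw [Finset.sum_apply]
    rw [integral_finsetSum _ fun i _ => (hgi i).integrable one_le_two]
    refine Finset.sum_eq_zero fun i _ => ?_
    have h := measurePreserving_eval (fun _ : Fin n => expModel.law θ) i
    have h2 := integral_map (μ := Measure.pi fun _ : Fin n => expModel.law θ) (f := g)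
      h.measurable.aemeasurable (by fun_prop)
    rw [h.map_eq, integral_affine_law_expModel hθ] at h2
    exact h2.symm
  have hfish : Var[g; expModel.law θ] = expModel.fisherInfo θ := by
    rw [variance_of_integral_eq_zero (by fun_prop) (integral_affine_law_expModel hθ),
      ParamModel.fisherInfo]
    refine integral_congr_ae ?_
    filter_upwards [score_expModel_ae hθ] with x hx
    rw [hx]
  refine ⟨?_, ?_, ?_, ?_, ?_, ?_⟩
  · refine hmem.integrable_sq.congr ?_
    filter_upwards [score_expModel_ae hθ] with x hx
    rw [hx]
  · rw [fisherInfo_expModel hθ]; positivity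
  · exact hsum.integrable_sq.congr hd.symm
  · rw [integral_congr_ae hd, ← variance_of_integral_eq_zero
      hsum.aestronglyMeasurable.aemeasurable hmean, ParamModel.sampleLaw,
      variance_sum_pi fun _ => hmem, hfish]
    simp
  · exact ((integrable_const _).sub ((his.const_mul 2).div_const _)).congr hd2.symm
  · rw [integral_congr_ae hd2, integral_sub (integrable_const _) ((his.const_mul 2).div_const _),
      integral_div _ (fun x : Fin n → ℝ => 2 * ∑ i, x i), integral_const_mul,
      integral_finsetSum _ fun i _ => integrable_eval_sampleLaw_expModel hθ i,
      fisherInfo_expModel hθ]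
    simp_rw [integral_eval_sampleLaw_expModel hθ]
    simp
    field_simp
    ring

lemma law_expModel_Ioo_pos {θ a b : ℝ} (hθ : 0 < θ) (ha : 0 ≤ a) (hab : a < b) :
    0 < expModel.law θ (Set.Ioo a b) := by
  rw [pos_iff_ne_zero, ParamModel.law, Ne,
    withDensity_apply_eq_zero (measurable_expModel_f θ).ennreal_ofReal]
  intro h
  have hsub : Set.Ioo a b ⊆ {x | ENNReal.ofReal (expModel.f θ x) ≠ 0} ∩ Set.Ioo a b := by
    refine fun x hx => ⟨?_, hx⟩
    rw [Set.mem_ofPred_eq, expModel_f_of_pos θ (lt_of_le_of_lt ha hx.1)]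
    exact (ENNReal.ofReal_pos.2 (by positivity)).ne'
  have := measure_mono_null hsub h
  simp at this
  linarith

lemma measurable_sampleMean (n : ℕ) : Measurable (sampleMean : (Fin n → ℝ) → ℝ) := by
  unfold sampleMean; fun_prop

lemma sampleLaw_expModel_sampleMean_pos {n : ℕ} (hn : 1 ≤ n) {θ ε : ℝ} (hθ : 0 < θ)
    (hε : 0 < ε) : 0 < expModel.sampleLaw n θ {x | |sampleMean x - θ| < ε} := by
  have := isProbabilityMeasure_law_expModel hθ
  have h0 : (0 : ℝ) < n := by exact_mod_cast hn
  have hne : Nonempty (Fin n) := ⟨⟨0, hn⟩⟩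
  -- A box on which every coordinate is close to θ lies in the event, and its probability is a
  -- product of positive factors.
  have hsub : Set.univ.pi (fun _ : Fin n => Set.Ioo θ (θ + ε)) ⊆
      {x | |sampleMean x - θ| < ε} := by
    intro x hx
    simp only [Set.mem_pi, Set.mem_univ, true_implies, Set.mem_Ioo] at hx
    have h1 : ∑ _i : Fin n, θ < ∑ i, x i :=
      Finset.sum_lt_sum_of_nonempty Finset.univ_nonempty fun i _ => (hx i).1
    have h2 : ∑ i, x i < ∑ _i : Fin n, (θ + ε) :=
      Finset.sum_lt_sum_of_nonempty Finset.univ_nonempty fun i _ => (hx i).2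
    simp only [Finset.sum_const, Finset.card_univ, Fintype.card_fin, nsmul_eq_mul] at h1 h2
    have h3 : θ < sampleMean x := by rw [sampleMean, lt_div_iff₀ h0]; linarith
    have h4 : sampleMean x < θ + ε := by rw [sampleMean, div_lt_iff₀ h0]; linarith
    rw [Set.mem_ofPred_eq, abs_lt]
    constructor <;> linarith
  refine lt_of_lt_of_le ?_ (measure_mono hsub)
  rw [ParamModel.sampleLaw, Measure.pi_pi, pos_iff_ne_zero, Finset.prod_ne_zero_iff]
  exact fun i _ => (law_expModel_Ioo_pos hθ hθ.le (by linarith)).ne'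

/-- The majorant depends on the sample only through its sum, which is bounded on the conditioning
event; hence all its conditional moments are finite. -/
lemma o2_expModel {n : ℕ} (hn : 1 ≤ n) : expModel.O2 n sampleMean := by
  intro θ₀ (hθ₀ : 0 < θ₀)
  refine ⟨_, _, thirdDerivBound_expModel n hθ₀, fun ε hε _ => ?_⟩
  have hpos := sampleLaw_expModel_sampleMean_pos hn hθ₀ hε
  have h0 : (0 : ℝ) < n := by exact_mod_cast hn
  have := isProbabilityMeasure_law_expModel hθ₀
  have : IsProbabilityMeasure (expModel.sampleLaw n θ₀) := by
    unfold ParamModel.sampleLaw; infer_instance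
  have hms : MeasurableSet {x : Fin n → ℝ | |sampleMean x - θ₀| < ε} := by
    have := measurable_sampleMean n
    exact measurableSet_lt (by fun_prop) (by fun_prop)
  refine ⟨hpos, fun κ _ => ?_⟩
  refine Integrable.of_bound (C := (2 * n / (θ₀ / 2) ^ 3 +
    6 * (n * (θ₀ + ε)) / (θ₀ / 2) ^ 4) ^ κ) ?_ ?_
  · unfold thirdDerivMajorant
    fun_prop
  · filter_upwards [ae_cond_mem hms] with x (hx : |sampleMean x - θ₀| < ε)
    have hs : |∑ i, x i| ≤ n * (θ₀ + ε) := by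
      have : ∑ i, x i = n * sampleMean x := by rw [sampleMean]; field_simp
      rw [this, abs_mul, abs_of_pos h0]
      refine mul_le_mul_of_nonneg_left (abs_le.2 ?_) h0.le
      have := abs_lt.1 hx
      constructor <;> linarith
    have hM : 0 ≤ thirdDerivMajorant n θ₀ x := by unfold thirdDerivMajorant; positivity
    rw [Real.norm_eq_abs, abs_of_nonneg (pow_nonneg hM κ)]
    refine pow_le_pow_left₀ hM ?_ κ
    unfold thirdDerivMajorant
    gcongr

/-! ### Supremum norms, the chi-square law, and the final bounds. -/

lemma abs_le_supNorm {g : ℝ → ℝ} (hg : ∃ C, ∀ x, |g x| ≤ C) (x : ℝ) : |g x| ≤ supNorm g := by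
  obtain ⟨C, hC⟩ := hg
  exact le_ciSup (f := fun x => |g x|) ⟨C, by rintro _ ⟨y, rfl⟩; exact hC y⟩ x

lemma supNorm_nonneg (g : ℝ → ℝ) : 0 ≤ supNorm g := Real.iSup_nonneg fun _ => abs_nonneg _

lemma supNorm_pos {g : ℝ → ℝ} (hg : ∃ C, ∀ x, |g x| ≤ C) (h0 : g ≠ 0) : 0 < supNorm g := by
  obtain ⟨x, hx⟩ := Function.ne_iff.1 h0
  exact (abs_pos.2 hx).trans_le (abs_le_supNorm hg x)

lemma IsCb2.abs_sub_le {h : ℝ → ℝ} (hh : IsCb2 h) (t : ℝ) :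
    |h t - h 0| ≤ supNorm (deriv h) * |t| := by
  have := convex_univ.norm_image_sub_le_of_norm_deriv_le (f := h) (x := 0) (y := t)
    (C := supNorm (deriv h))
    (fun x _ => (hh.contDiff.differentiable (by norm_num)).differentiableAt)
    (fun x _ => abs_le_supNorm hh.bdd_deriv x) (Set.mem_univ _) (Set.mem_univ _)
  simpa using this

lemma integral_chiSquaredMeasure_one {h : ℝ → ℝ} (hh : Measurable h) :
    ∫ t, h t ∂chiSquaredMeasure 1 = ∫ z, h (z ^ 2) ∂gaussianReal 0 1 := by
  rw [chiSquaredMeasure, integral_map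
    (by fun_prop : Measurable fun z : Fin 1 → ℝ => ∑ i, z i ^ 2).aemeasurable
    hh.aestronglyMeasurable]
  have hmp := measurePreserving_eval (fun _ : Fin 1 => gaussianReal 0 1) 0
  have := integral_map (μ := Measure.pi fun _ : Fin 1 => gaussianReal 0 1)
    (f := fun z : ℝ => h (z ^ 2)) hmp.measurable.aemeasurable
    (by exact (hh.comp (measurable_id.pow_const 2)).aestronglyMeasurable)
  rw [hmp.map_eq] at this
  simpa using this.symm

lemma scoreTerm_pos {θ₀ : ℝ} (hθ₀ : 0 < θ₀) (n : ℕ) : 0 < scoreTerm θ₀ n := by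
  have := Real.pi_pos
  unfold scoreTerm
  positivity

/-- The first summand, at least 6, already suffices. -/
lemma three_le_remainderTerm (n : ℕ) : 3 ≤ remainderTerm n := by
  have h1 : 1 ≤ √(3 + 6 / (n : ℝ)) := by
    rw [Real.one_le_sqrt]
    have : (0 : ℝ) ≤ 6 / n := by positivity
    linarith
  unfold remainderTerm
  have h2 : 0 ≤ √(15 + 130 / (n : ℝ) + 120 / (n : ℝ) ^ 2) *
    (1120 / 3 + (320 * (3 + 6 / (n : ℝ)) ^ (1 / 4 : ℝ) + 4) / √(n : ℝ)) := by positivity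
  have h3 : 0 ≤ 6400 / √(n : ℝ) *
    √(105 + 2380 / (n : ℝ) + 7308 / (n : ℝ) ^ 2 + 5040 / (n : ℝ) ^ 3) := by positivity
  linarith

/-- The Wilks statistic of the exponential model is within `3 ‖h'‖ / √n` of `χ²₁`. -/
lemma abs_integral_likelihoodRatio_sub_le {Ω Ω' : Type*} [MeasurableSpace Ω] [MeasurableSpace Ω']
    {P : Measure Ω} [IsProbabilityMeasure P] {P' : Measure Ω'}
    {n : ℕ} (hn : 1 ≤ n) {θ₀ : ℝ} (hθ₀ : 0 < θ₀)
    {X : Fin n → Ω → ℝ} (hX : ∀ i, HasLaw (X i) (expMeasure (1 / θ₀)) P) (hind : iIndepFun X P)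
    (hpos : ∀ᵐ ω ∂P, ∀ i, 0 < X i ω)
    {K : Ω' → ℝ} (hK : HasLaw K (chiSquaredMeasure 1) P') {h : ℝ → ℝ} (hh : IsCb2 h) :
    |(∫ ω, h (2 * (expModel.loglik (sampleMean fun i => X i ω) (fun i => X i ω) -
        expModel.loglik θ₀ (fun i => X i ω))) ∂P) - ∫ ω, h (K ω) ∂P'| ≤
      3 * supNorm (deriv h) / √(n : ℝ) := by
  have hhm : Measurable h := hh.contDiff.continuous.measurable
  have hne : Nonempty (Fin n) := ⟨⟨0, hn⟩⟩
  have hr : 0 < 1 / θ₀ := by positivity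
  have h0 : (0 : ℝ) < n := by exact_mod_cast hn
  have hS := hasLaw_sum_gammaMeasure hr hX hind Finset.univ_nonempty
  rw [Finset.card_univ, Fintype.card_fin] at hS
  have hm := measurable_halfDeviance
  have e1 : ∫ ω, h (2 * (expModel.loglik (sampleMean fun i => X i ω) (fun i => X i ω) -
      expModel.loglik θ₀ (fun i => X i ω))) ∂P =
      ∫ s, h (2 * n * halfDeviance (s / (n / (1 / θ₀)))) ∂gammaMeasure n (1 / θ₀) := by
    rw [← hS.integral_comp (f := fun s => h (2 * n * halfDeviance (s / (n / (1 / θ₀)))))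
      (hhm.comp ((hm.comp (by fun_prop)).const_mul _)).aestronglyMeasurable]
    refine integral_congr_ae ?_
    filter_upwards [hpos] with ω hω
    rw [loglik_sampleMean_sub hn hω hθ₀, ← mul_assoc, Function.comp_apply, Finset.sum_apply,
      sampleMean]
    congr 3
    field_simp
  have e2 : ∫ ω, h (K ω) ∂P' = ∫ z, h (z ^ 2) ∂gaussianReal 0 1 := by
    rw [← integral_chiSquaredMeasure_one hhm, ← hK.integral_comp hhm.aestronglyMeasurable]
    rfl
  obtain ⟨C, hC⟩ := hh.bdd
  rw [e1, e2]
  exact abs_integral_deviance_gamma_sub_le hn hr hhm hC hh.abs_sub_le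

theorem corollary1 {Ω Ω' : Type*} [MeasurableSpace Ω] [MeasurableSpace Ω']
    (P : Measure Ω) [IsProbabilityMeasure P] (P' : Measure Ω') [IsProbabilityMeasure P']
    (n : ℕ) (hn : 1 ≤ n) (θ₀ : ℝ) (hθ₀ : 0 < θ₀)
    (X : Fin n → Ω → ℝ) (hX : ∀ i, HasLaw (X i) (expMeasure (1 / θ₀)) P) (hind : iIndepFun X P)
    (K : Ω' → ℝ) (hK : HasLaw K (chiSquaredMeasure 1) P') :
    -- the MLE exists, is unique and equals the sample mean
    (∀ x ∈ expModel.sampleSupport n, ∀ θ, expModel.IsMLE x θ ↔ θ = sampleMean x) ∧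
    (∀ᵐ ω ∂P, (fun i => X i ω) ∈ expModel.sampleSupport n) ∧
    -- the regularity conditions
    (expModel.RC1 ∧ expModel.RC2 n ∧ expModel.RC3 n ∧ expModel.RC4 ∧ expModel.RC5 n ∧
      expModel.O2 n sampleMean ∧ expModel.O3) ∧
    -- the bounds
    ∀ h : ℝ → ℝ, IsCb2 h →
      |(∫ ω, h (2 * (expModel.loglik (sampleMean fun i => X i ω) (fun i => X i ω) -
          expModel.loglik θ₀ (fun i => X i ω))) ∂P) - ∫ ω, h (K ω) ∂P'| <
        8 * supNorm h / n + scoreTerm θ₀ n + supNorm (deriv h) / √(n : ℝ) * remainderTerm n ∧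
      (h ≠ 0 →
      |(∫ ω, h (2 * (expModel.loglik (sampleMean fun i => X i ω) (fun i => X i ω) -
          expModel.loglik θ₀ (fun i => X i ω))) ∂P) - ∫ ω, h (K ω) ∂P'| <
        8 * supNorm h / n +
        2 * (supNorm (deriv h) + supNorm (iteratedDeriv 2 h)) / √(n : ℝ) * scoreTerm θ₀ n +
        supNorm (deriv h) / √(n : ℝ) * remainderTerm n) := by

  have h0 : (0 : ℝ) < n := by exact_mod_cast hn
  have hpos : ∀ᵐ ω ∂P, ∀ i, 0 < X i ω := by
    refine ae_all_iff.2 fun i => ?_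
    have := ae_law_expModel_pos θ₀
    rw [law_expModel, ← (hX i).map_eq] at this
    exact ae_of_ae_map (hX i).aemeasurable this
  refine ⟨fun x hx θ => isMLE_expModel_iff hn (mem_sampleSupport_expModel.1 hx) θ,
    hpos.mono fun ω hω => mem_sampleSupport_expModel.2 hω,
    ⟨rc1_expModel, rc2_expModel n, rc3_expModel n, rc4_expModel, rc5_expModel n, o2_expModel hn,
      o3_expModel⟩, fun h hh => ?_⟩
  have hmain := abs_integral_likelihoodRatio_sub_le hn hθ₀ hX hind hpos hK hh
  have hS := scoreTerm_pos hθ₀ n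
  have hd := supNorm_nonneg (deriv h)
  have hd2 := supNorm_nonneg (iteratedDeriv 2 h)
  have hR : 3 * supNorm (deriv h) / √(n : ℝ) ≤ supNorm (deriv h) / √(n : ℝ) * remainderTerm n := by
    rw [mul_comm 3, mul_div_right_comm]
    exact mul_le_mul_of_nonneg_left (three_le_remainderTerm n) (by positivity)
  -- The main estimate is not strict. Strictness comes from the positive score term in the first
  -- bound, and from ‖h‖ > 0 in the second, where the score term vanishes for constant h.
  constructor
  · have : 0 ≤ 8 * supNorm h / n := by
      have := supNorm_nonneg h
      positivity
    linarith
  · intro hne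
    have h1 : 0 < 8 * supNorm h / n := by
      have := supNorm_pos hh.bdd hne
      positivity
    have h2 : 0 ≤ 2 * (supNorm (deriv h) + supNorm (iteratedDeriv 2 h)) / √(n : ℝ) *
      scoreTerm θ₀ n := by positivity
    linarith
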